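/- **Setting.** Fix a lattice of squares in $\mathbb{R}^2$ with side length $h_0>0$ and let $\Omega$ be the interior of the union of finitely many closed squares of this lattice. A *cell of level* $\ell\ge 0$ is an open square obtained from a lattice square by $\ell$ successive subdivisions into four congruent squares. A *partition* $P$ of $\Omega$ is a finite set of pairwise disjoint cells (of possibly different levels) whose closures cover $\overline\Omega$ exactly. Put $h_\omega=\operatorname{diam}(\omega)$. The *edges* of a cell are its four open sides; an edge is *interior* if it is contained in $\Omega$. Let $r\ge 2$, let $\mathcal{P}^r_P(\Omega)$ be the functions that on each cell of $P$ are polynomials of degree at most $r$ in each variable, and let $\mathbb{X}_P\subseteq\mathcal{P}^r_P(\Omega)\cap C^1(\Omega)$ be a spline space spanned by a finite set $\mathcal{B}_P$ (for instance a hierarchical B-spline basis). For $\tau\in P$ let $\omega_\tau$ be the set of all $\tau'\in P$ for which some $\beta\in\mathcal{B}_P$ has a support that meets both $\tau$ and $\tau'$. For a constant $c_{\rm shape}>0$ the partition (with its basis) is called *shape regular* if for every $\tau\in P$ $$\#\,\omega_\tau\le c_{\rm shape},\qquad h_\tau\le c_{\rm shape}\,h_\sigma\ \text{ for every edge }\sigma\text{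 of a cell of }P\text{ with }\sigma\subset\partial\tau,\qquad \operatorname{diam}\Big(\bigcup_{\tau'\in\omega_\tau}\tau'\Big)\le c_{\rm shape}\,h_\tau .$$ Given $f\in L^2(\Omega)$, set $$\eta_P^2(V,\tau)=h_\tau^4\|f-\Delta^2V\|_{L^2(\tau)}^2+\sum_{\sigma}\Big(h_\sigma^3\Big\|\Big[\!\Big[\tfrac{\partial\Delta V}{\partial n_\sigma}\Big]\!\Big]_\sigma\Big\|_{L^2(\sigma)}^2+h_\sigma\big\|[\![\Delta V]\!]_\sigma\big\|_{L^2(\sigma)}^2\Big),$$ where the sum is over the interior edges $\sigma$ of $\tau$ and $[\![\cdot]\!]_\sigma$ is the jump across $\sigma$. For $S\subseteq P$ put $\eta_P^2(V,S)=\sum_{\tau\in S}\eta_P^2(V,\tau)$ and $\eta_P^2(V,\Omega)=\eta_P^2(V,P)$. Finally let $|\!|\!|w|\!|\!|=\|\Delta w\|_{L^2(\Omega)}$. **Lemma (Estimator error reduction).** For every $r\ge2$ and $c_{\rm shape}>0$ there is a constant $C>0$, depending only on $r$ and $c_{\rm shape}$, such that the following holds. Let $P$ be a partition of $\Omega$ that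 is shape regular with constant $c_{\rm shape}$, let $\mathcal{M}\subseteq P$, and let $P_*$ be a partition of $\Omega$, also shape regular with constant $c_{\rm shape}$, that is obtained from $P$ by subdividing cells, where every cell of $\mathcal{M}$ is subdivided at least once. Then for every $f\in L^2(\Omega)$, every $\delta>0$ and all splines $V\in\mathbb{X}_P$ and $V_*\in\mathbb{X}_{P_*}$, $$\eta_{P_*}^2(V_*,\Omega)\le(1+\delta)\Big\{\eta_P^2(V,\Omega)-\tfrac12\,\eta_P^2(V,\mathcal{M})\Big\}+C\Big(1+\frac1\delta\Big)|\!|\!|V-V_*|\!|\!|^2 .$$ -/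

import Mathlib

open MeasureTheory Set Filter Topology

noncomputable section

namespace SplineAFEM

/-- The Euclidean plane. -/
abbrev Plane := EuclideanSpace ℝ (Fin 2)

/-- The uniform initial grid of squares: a lattice point and the side length of its cells. Cells of
level `ℓ` are obtained by `ℓ` successive subdivisions of a square into four congruent squares. -/
structure Grid where
  origin : Plane
  size : ℝ
  size_pos : 0 < size

/-- A square cell is named by its level and its two integer lattice indices at that level. -/
abbrev Cell := ℕ × (Fin 2 → ℤ)

/-- An edge (side) of a square: the coordinate direction normal to it, and whether it is the upper
(`true`) or the lower (`false`) one of the two sides normal to that direction. -/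
abbrev Side := Fin 2 × Bool

namespace Grid

variable (G : Grid)

/-- Side length of the cell `τ`. -/
def len (τ : Cell) : ℝ := G.size / 2 ^ τ.1

/-- Coordinates of the lower left corner of the cell `τ`. -/
def corner (τ : Cell) (i : Fin 2) : ℝ := G.origin i + G.len τ * (τ.2 i : ℝ)

/-- The open square `τ`. -/
def cell (τ : Cell) : Set Plane :=
  {x | ∀ i, G.corner τ i < x i ∧ x i < G.corner τ i + G.len τ}

/-- The closed square. -/
def closedCell (τ : Cell) : Set Plane :=
  {x | ∀ i, G.corner τ i ≤ x i ∧ x i ≤ G.corner τ i + G.len τ}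

/-- The polygonal domain `Ω` made of finitely many cells of the initial grid. -/
def domain (Q : Finset (Fin 2 → ℤ)) : Set Plane :=
  interior (⋃ k ∈ Q, G.closedCell (0, k))

/-- `P` is a hierarchical partition of `Ω` into disjoint open squares. -/
def IsPartition (Q : Finset (Fin 2 → ℤ)) (P : Finset Cell) : Prop :=
  (P : Set Cell).PairwiseDisjoint G.cell ∧
    ⋃ τ ∈ P, G.closedCell τ = closure (G.domain Q)

/-- `Ps` is a refinement of the partition `P` in which every cell of the marked set `M` has been
subdivided (further cells may have been subdivided as well, and cells may have been subdivided
repeatedly). -/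
def IsRefinement (P M Ps : Finset Cell) : Prop :=
  (∀ τs ∈ Ps, ∃ τ ∈ P, G.cell τs ⊆ G.cell τ) ∧ ∀ τ ∈ M, τ ∉ Ps

/-- The point of the line carrying the side `e` of `τ` whose tangential coordinate is `t`. -/
def sidePoint (τ : Cell) (e : Side) (t : ℝ) : Plane :=
  WithLp.toLp 2 (Function.update (fun _ => t) e.1
    (G.corner τ e.1 + if e.2 then G.len τ else 0))

/-- The side `e` of `τ`, without its endpoints. -/
def side (τ : Cell) (e : Side) : Set Plane :=
  G.sidePoint τ e '' Ioo (G.corner τ (1 - e.1)) (G.corner τ (1 - e.1) + G.len τ)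

/-- The square of the `L²` norm of `g` on the side `e` of `τ`, in arc length. -/
def sideL2Sq (τ : Cell) (e : Side) (g : Plane → ℝ) : ℝ :=
  ∫ t in (G.corner τ (1 - e.1))..(G.corner τ (1 - e.1) + G.len τ), g (G.sidePoint τ e t) ^ 2

end Grid

/-- The outward unit normal on the side `e` of a square. -/
def normal (e : Side) : Plane := EuclideanSpace.single e.1 (if e.2 then 1 else -1)

/-- The jump of `g` at `x` in the direction `n`: the difference of the one-sided limits along the
normal line. -/
def jump (n : Plane) (g : Plane → ℝ) (x : Plane) : ℝ :=
  limUnder (𝓝[>] (0 : ℝ)) (fun t => g (x + t • n)) -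
    limUnder (𝓝[>] (0 : ℝ)) (fun t => g (x - t • n))

/-- The classical Laplacian. For a `C¹` piecewise polynomial function it is defined off the edges
of the cells, that is almost everywhere, and agrees there with the weak Laplacian. -/
def lap (V : Plane → ℝ) : Plane → ℝ := Laplacian.laplacian V

namespace Grid

variable (G : Grid)

/-- `V` lies in `𝒫ʳ_P(Ω) ∩ C¹(Ω)`: it is continuously differentiable on `Ω` and on every cell a
polynomial of degree at most `r` in each variable. -/
def IsSpline (Q : Finset (Fin 2 → ℤ)) (r : ℕ) (P : Finset Cell) (V : Plane → ℝ) : Prop :=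
  ContDiffOn ℝ 1 V (G.domain Q) ∧
    ∀ τ ∈ P, ∃ p : MvPolynomial (Fin 2) ℝ, (∀ i, p.degreeOf i ≤ r) ∧
      ∀ x ∈ G.cell τ, V x = MvPolynomial.eval (fun i => x i) p

/-- The support extension `ω_τ` of `τ` relative to the basis functions `B`: all cells that meet the
support of a basis function whose support meets `τ`. (Cells are open, so it makes no difference
whether the supports are closed up.) -/
def supportExtension (P : Finset Cell) (B : Finset (Plane → ℝ)) (τ : Cell) : Set Cell :=
  {τ' | τ' ∈ P ∧ ∃ β ∈ B, (Function.support β ∩ G.cell τ).Nonempty ∧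
    (Function.support β ∩ G.cell τ').Nonempty}

/-- The shape regularity conditions with constant `c`: finite intersection, mesh grading and
quasi-uniformity. In the mesh grading condition `σ` runs through the sides of all cells of `P`
that are contained in the boundary of `τ`, so sides of smaller neighbours are included. -/
def ShapeRegular (P : Finset Cell) (B : Finset (Plane → ℝ)) (c : ℝ) : Prop :=
  (∀ τ ∈ P, ((G.supportExtension P B τ).ncard : ℝ) ≤ c) ∧
  (∀ τ ∈ P, ∀ τ' ∈ P, ∀ e : Side, G.side τ' e ⊆ frontier (G.cell τ) →
    Metric.diam (G.cell τ) ≤ c * Metric.diam (G.side τ' e)) ∧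
  (∀ τ ∈ P, Metric.diam (⋃ τ' ∈ G.supportExtension P B τ, G.cell τ') ≤
    c * Metric.diam (G.cell τ))

open Classical in
/-- The error indicator `η²(V, τ)`: the element residual of `Δ²V = f` on `τ`, and the jumps of
`∂ΔV/∂n` and `ΔV` across those sides of `τ` that are interior to `Ω`. -/
def indicatorSq (Q : Finset (Fin 2 → ℤ)) (f V : Plane → ℝ) (τ : Cell) : ℝ :=
  Metric.diam (G.cell τ) ^ 4 * (∫ x in G.cell τ, (f x - lap (lap V) x) ^ 2) +
    ∑ e : Side, if G.side τ e ⊆ G.domain Q then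
      Metric.diam (G.side τ e) ^ 3 *
          G.sideL2Sq τ e (jump (normal e) fun y => fderiv ℝ (lap V) y (normal e)) +
        Metric.diam (G.side τ e) * G.sideL2Sq τ e (jump (normal e) (lap V))
    else 0

/-- The error estimator `η²(V, S)` over a set `S` of cells. -/
def estimatorSq (Q : Finset (Fin 2 → ℤ)) (f V : Plane → ℝ) (S : Finset Cell) : ℝ :=
  ∑ τ ∈ S, G.indicatorSq Q f V τ

/-- The square `‖Δw‖²` in `L²(Ω)` of the energy norm. -/
def energySq (Q : Finset (Fin 2 → ℤ)) (w : Plane → ℝ) : ℝ :=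
  ∫ x in G.domain Q, lap w x ^ 2

end Grid

end SplineAFEM

end

/-! The coarse spline `V`, viewed on the fine partition, is an intermediate point between the two
estimators.

Changing the spline on the fine partition: residuals and jumps depend affinely on the spline, so
Young's inequality bounds the estimator of `Vs` by `1 + δ` times that of `V`, plus `1 + 1 / δ` times
the estimator of `V - Vs` with zero load (`estimatorSq_le_young`). The last quantity involves only
piecewise polynomials. On a cell of side `h`, with `L` the Laplacian of the difference, the inverse
estimate `h² ‖∂L‖² ≤ K ‖L‖²` and the trace estimate `h ‖L‖²_side ≤ K ‖L‖²` absorb exactly the powers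
of `h` in the indicator (`exists_inverse_estimate_cell`). Both reduce, by restriction to coordinate
lines and scaling, to univariate polynomials on the unit interval, where compactness gives the
constant. A jump also contains the neighbour's trace, weighted by the size of the wrong cell; mesh
grading makes the two sizes comparable (`sum_jumpTerm_le`). The sum is then at most a constant times
the energy (`exists_estimatorSq_zero_le`).

Changing the partition for fixed `V` (`estimatorSq_refinement_le`): inside an old cell `V` is a
polynomial, so new edges there carry no jump, and pieces of old edges add up to at most the old
integrals. Only the weights change. In a marked cell all descendants have at most half the side
length, and every weight is at least a first power of it, whence the factor `1 / 2`. -/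

noncomputable section

namespace SplineAFEM

/-! ### Polynomials on the plane and their derivatives -/

/-- The function on the plane defined by a polynomial in two variables. -/
def polyFun (p : MvPolynomial (Fin 2) ℝ) (x : Plane) : ℝ := MvPolynomial.eval (fun i => x i) p

/-- The Laplacian of a polynomial, as a polynomial. -/
def lapPoly (p : MvPolynomial (Fin 2) ℝ) : MvPolynomial (Fin 2) ℝ :=
  ∑ i, MvPolynomial.pderiv i (MvPolynomial.pderiv i p)

theorem polyFun_add (p q : MvPolynomial (Fin 2) ℝ) (x : Plane) :
    polyFun (p + q) x = polyFun p x + polyFun q x := by simp [polyFun]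

theorem polyFun_sub (p q : MvPolynomial (Fin 2) ℝ) (x : Plane) :
    polyFun (p - q) x = polyFun p x - polyFun q x := by simp [polyFun]

theorem polyFun_smul (a : ℝ) (p : MvPolynomial (Fin 2) ℝ) (x : Plane) :
    polyFun (a • p) x = a * polyFun p x := by simp [polyFun, MvPolynomial.smul_eval]

theorem lapPoly_sub (p q : MvPolynomial (Fin 2) ℝ) :
    lapPoly (p - q) = lapPoly p - lapPoly q := by simp [lapPoly, Finset.sum_sub_distrib]

theorem hasFDerivAt_polyFun (p : MvPolynomial (Fin 2) ℝ) (x : Plane) :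
    HasFDerivAt (polyFun p)
      (∑ i, polyFun (MvPolynomial.pderiv i p) x • (EuclideanSpace.proj i : Plane →L[ℝ] ℝ)) x := by
  induction p using MvPolynomial.induction_on with
  | C a =>
    have : polyFun (MvPolynomial.C a) = fun _ => a := by ext; simp [polyFun]
    rw [this]
    simpa [polyFun] using hasFDerivAt_const a x
  | add p q hp hq =>
    have : polyFun (p + q) = polyFun p + polyFun q := by ext; simp [polyFun]
    rw [this]
    refine (hp.add hq).congr_fderiv ?_
    ext v
    simp [polyFun]
    ring
  | mul_X p j hp =>
    have : polyFun (p * MvPolynomial.X j) =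
        polyFun p * fun y : Plane => (EuclideanSpace.proj j : Plane →L[ℝ] ℝ) y := by
      ext; simp [polyFun]
    rw [this]
    refine (hp.mul (EuclideanSpace.proj j : Plane →L[ℝ] ℝ).hasFDerivAt).congr_fderiv ?_
    ext v
    fin_cases j <;> (simp [polyFun, MvPolynomial.pderiv_X]; ring)

theorem continuous_polyFun (p : MvPolynomial (Fin 2) ℝ) : Continuous (polyFun p) :=
  continuous_iff_continuousAt.2 fun x => (hasFDerivAt_polyFun p x).continuousAt

theorem fderiv_polyFun_single (p : MvPolynomial (Fin 2) ℝ) (x : Plane) (i : Fin 2) (a : ℝ) :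
    fderiv ℝ (polyFun p) x (EuclideanSpace.single i a) =
      a * polyFun (MvPolynomial.pderiv i p) x := by
  rw [(hasFDerivAt_polyFun p x).fderiv]
  fin_cases i <;> simp [mul_comm]

theorem lap_polyFun (p : MvPolynomial (Fin 2) ℝ) : lap (polyFun p) = polyFun (lapPoly p) := by
  unfold lap
  rw [InnerProductSpace.laplacian_eq_iteratedFDeriv_orthonormalBasis _
    (EuclideanSpace.basisFun (Fin 2) ℝ)]
  ext x
  have hd : DifferentiableAt ℝ (fderiv ℝ (polyFun p)) x := by
    have : fderiv ℝ (polyFun p) = fun y => ∑ i, polyFun (MvPolynomial.pderiv i p) y •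
        (EuclideanSpace.proj i : Plane →L[ℝ] ℝ) :=
      funext fun y => (hasFDerivAt_polyFun p y).fderiv
    rw [this]
    exact DifferentiableAt.fun_sum fun i _ =>
      ((hasFDerivAt_polyFun _ x).differentiableAt).smul_const _
  have key : ∀ i : Fin 2, fderiv ℝ (fderiv ℝ (polyFun p)) x (EuclideanSpace.single i 1)
      (EuclideanSpace.single i 1) =
      polyFun (MvPolynomial.pderiv i (MvPolynomial.pderiv i p)) x := by
    intro i
    have h1 : (fun y => fderiv ℝ (polyFun p) y (EuclideanSpace.single i 1)) =
        polyFun (MvPolynomial.pderiv i p) := by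
      ext y; rw [fderiv_polyFun_single, one_mul]
    have h2 := fderiv_polyFun_single (MvPolynomial.pderiv i p) x i 1
    rw [← h1, fderiv_clm_apply hd (differentiableAt_const _)] at h2
    simpa using h2
  simp [iteratedFDeriv_two_apply, key, lapPoly, polyFun]

/-- The Laplacian is local, so agreement on an open set suffices. This is how the classical
operators are evaluated off the edges. -/
theorem lap_eq_of_eqOn {U : Set Plane} (hU : IsOpen U) {g : Plane → ℝ}
    {p : MvPolynomial (Fin 2) ℝ} (h : EqOn g (polyFun p) U) :
    EqOn (lap g) (polyFun (lapPoly p)) U := by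
  intro x hx
  rw [← lap_polyFun]
  exact (InnerProductSpace.laplacian_congr_nhds
    (h.eventuallyEq_of_mem (hU.mem_nhds hx))).eq_of_nhds

theorem fderiv_single_eq_of_eqOn {U : Set Plane} (hU : IsOpen U) {g : Plane → ℝ}
    {p : MvPolynomial (Fin 2) ℝ} (h : EqOn g (polyFun p) U) (i : Fin 2) (a : ℝ) :
    EqOn (fun y => fderiv ℝ g y (EuclideanSpace.single i a))
      (polyFun (a • MvPolynomial.pderiv i p)) U := by
  intro x hx
  simp only
  rw [(h.eventuallyEq_of_mem (hU.mem_nhds hx)).fderiv_eq, fderiv_polyFun_single, polyFun_smul]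

theorem pderiv_mem_restrictDegree {r : ℕ} {p : MvPolynomial (Fin 2) ℝ}
    (hp : p ∈ MvPolynomial.restrictDegree (Fin 2) ℝ r) (i : Fin 2) :
    MvPolynomial.pderiv i p ∈ MvPolynomial.restrictDegree (Fin 2) ℝ r := by
  rw [MvPolynomial.mem_restrictDegree] at *
  intro s hs j
  rw [MvPolynomial.mem_support_iff, MvPolynomial.coeff_pderiv] at hs
  have h := hp (s + Finsupp.single i 1) (MvPolynomial.mem_support_iff.2 (left_ne_zero_of_mul hs)) j
  simp only [Finsupp.add_apply] at h
  lia

theorem lapPoly_mem_restrictDegree {r : ℕ} {p : MvPolynomial (Fin 2) ℝ}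
    (hp : p ∈ MvPolynomial.restrictDegree (Fin 2) ℝ r) :
    lapPoly p ∈ MvPolynomial.restrictDegree (Fin 2) ℝ r :=
  Submodule.sum_mem _ fun i _ => pderiv_mem_restrictDegree (pderiv_mem_restrictDegree hp i) i

theorem mem_restrictDegree_iff_degreeOf_le {r : ℕ} {p : MvPolynomial (Fin 2) ℝ} :
    p ∈ MvPolynomial.restrictDegree (Fin 2) ℝ r ↔ ∀ i, p.degreeOf i ≤ r := by
  simp only [MvPolynomial.mem_restrictDegree, MvPolynomial.degreeOf_le_iff]
  exact ⟨fun h i s hs => h s hs i, fun h s hs i => h i s hs⟩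

/-! ### Coordinate lines -/

/-- The point whose `i`-th coordinate is `s` and whose other coordinate is `t`. -/
def pt (i : Fin 2) (s t : ℝ) : Plane := WithLp.toLp 2 (Function.update (fun _ => t) i s)

@[simp] theorem pt_apply_self (i : Fin 2) (s t : ℝ) : pt i s t i = s := by simp [pt]

theorem one_sub_ne (i : Fin 2) : 1 - i ≠ i := by fin_cases i <;> simp

theorem forall_fin_two_iff {q : Fin 2 → Prop} (i : Fin 2) : (∀ j, q j) ↔ q i ∧ q (1 - i) := by
  fin_cases i <;> simp [Fin.forall_fin_two, and_comm]

@[simp] theorem pt_apply_other (i : Fin 2) (s t : ℝ) : pt i s t (1 - i) = t := by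
  simp [pt, one_sub_ne]

theorem pt_self (i : Fin 2) (x : Plane) : pt i (x i) (x (1 - i)) = x := by
  ext j
  revert j
  rw [forall_fin_two_iff i]
  simp

theorem continuous_pt (i : Fin 2) : Continuous fun z : ℝ × ℝ => pt i z.1 z.2 := by
  unfold pt
  fun_prop

/-- Allows Fubini with either coordinate as the inner variable. -/
theorem measurePreserving_pt (i : Fin 2) :
    MeasurePreserving (fun z : ℝ × ℝ => pt i z.1 z.2) volume volume := by
  have h0 : MeasurePreserving (fun z : ℝ × ℝ => pt 0 z.1 z.2) volume volume := by
    have h := (PiLp.volume_preserving_toLp (Fin 2)).comp (volume_preserving_finTwoArrow ℝ).symm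
    have e : (fun z : ℝ × ℝ => pt 0 z.1 z.2) =
        (WithLp.toLp 2 ∘ (MeasurableEquiv.finTwoArrow (α := ℝ)).symm) := by
      funext z
      refine PiLp.ext fun j => ?_
      fin_cases j <;> simp [pt, MeasurableEquiv.finTwoArrow]
    rw [e]
    exact h
  fin_cases i
  · exact h0
  · have h := h0.comp (Measure.measurePreserving_swap (μ := (volume : Measure ℝ))
      (ν := (volume : Measure ℝ)))
    have e : (fun z : ℝ × ℝ => pt 1 z.1 z.2) = (fun z : ℝ × ℝ => pt 0 z.1 z.2) ∘ Prod.swap := by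
      funext z
      refine PiLp.ext fun j => ?_
      fin_cases j <;> simp [pt]
    exact e ▸ h

theorem measurableEmbedding_pt (i : Fin 2) :
    MeasurableEmbedding (fun z : ℝ × ℝ => pt i z.1 z.2) := by
  refine (continuous_pt i).measurableEmbedding ?_
  intro z w h
  have h1 := congrArg (fun x : Plane => x i) h
  have h2 := congrArg (fun x : Plane => x (1 - i)) h
  simp at h1 h2
  exact Prod.ext h1 h2

/-- Restriction of a polynomial to a coordinate line. -/
theorem exists_polynomial_line {r : ℕ} {p : MvPolynomial (Fin 2) ℝ}
    (hp : p ∈ MvPolynomial.restrictDegree (Fin 2) ℝ r) (i : Fin 2) (t : ℝ) :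
    ∃ q : Polynomial ℝ, q.natDegree ≤ r ∧ (∀ s, polyFun p (pt i s t) = q.eval s) ∧
      ∀ s, polyFun (MvPolynomial.pderiv i p) (pt i s t) = q.derivative.eval s := by
  -- Substitute `X` for the `i`-th variable and the constant `t` for the other. Since `C t` has
  -- derivative zero, substitution turns `pderiv i` into the ordinary derivative.
  let v : Fin 2 → Polynomial ℝ := Function.update (fun _ => Polynomial.C t) i Polynomial.X
  have hv : ∀ (m : MvPolynomial (Fin 2) ℝ) (s : ℝ),
      polyFun m (pt i s t) = (MvPolynomial.aeval v m).eval s := by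
    intro m s
    rw [polyFun, MvPolynomial.aeval_def, MvPolynomial.eval₂_eq', MvPolynomial.eval_eq',
      Polynomial.eval_finsetSum]
    refine Finset.sum_congr rfl fun d _ => ?_
    rw [Polynomial.eval_mul, Polynomial.eval_prod]
    congr 1
    · simp
    · refine Finset.prod_congr rfl fun j _ => ?_
      rw [Polynomial.eval_pow]
      congr 1
      revert j
      simp only [Finset.mem_univ, forall_const]
      rw [forall_fin_two_iff i]
      simp [v, one_sub_ne]
  have hd : ∀ m : MvPolynomial (Fin 2) ℝ,
      MvPolynomial.aeval v (MvPolynomial.pderiv i m) =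
        (MvPolynomial.aeval v m).derivative := by
    intro m
    induction m using MvPolynomial.induction_on with
    | C a => simp
    | add p q hp hq => simp [hp, hq]
    | mul_X p j hp =>
      have : MvPolynomial.aeval v (MvPolynomial.pderiv i (MvPolynomial.X j : MvPolynomial (Fin 2) ℝ)) =
          (v j).derivative := by
        revert j
        rw [forall_fin_two_iff i]
        simp [v, one_sub_ne, MvPolynomial.pderiv_X]
      simp only [MvPolynomial.pderiv_mul, map_add, map_mul, hp, this, MvPolynomial.aeval_X,
        Polynomial.derivative_mul]
  refine ⟨MvPolynomial.aeval v p, ?_, fun s => hv p s, fun s => ?_⟩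
  · rw [MvPolynomial.mem_restrictDegree] at hp
    rw [MvPolynomial.aeval_def, MvPolynomial.eval₂_eq']
    refine Polynomial.natDegree_sum_le_of_forall_le _ _ fun d hd => ?_
    have h2 : (∏ j, v j ^ d j) = Polynomial.X ^ d i * Polynomial.C t ^ d (1 - i) := by
      rw [Fin.prod_univ_two]
      fin_cases i <;> simp [v, mul_comm]
    rw [h2, ← Polynomial.C_pow, ← mul_assoc, Polynomial.algebraMap_eq]
    refine (Polynomial.natDegree_mul_C_le _ _).trans ((Polynomial.natDegree_C_mul_le _ _).trans ?_)
    rw [Polynomial.natDegree_X_pow]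
    exact hp d hd i
  · rw [hv, hd]

/-! ### Inverse estimates in one variable -/

/-- On polynomials of bounded degree, the `L²` norm on the unit interval controls the
coefficients. -/
theorem exists_sq_norm_coeff_le (n : ℕ) : ∃ K : ℝ, 0 < K ∧ ∀ c : EuclideanSpace ℝ (Fin n),
    ‖c‖ ^ 2 ≤ K * ∫ x in (0 : ℝ)..1, (∑ k, c k * x ^ (k : ℕ)) ^ 2 := by
  let F : EuclideanSpace ℝ (Fin n) → ℝ := fun c => ∫ x in (0 : ℝ)..1, (∑ k, c k * x ^ (k : ℕ)) ^ 2
  have hF : Continuous F := by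
    refine intervalIntegral.continuous_parametric_intervalIntegral_of_continuous' ?_ 0 1
    fun_prop
  -- If the integral were not positive, the polynomial would vanish on all of `[0, 1]` and so have
  -- infinitely many roots.
  have hpos : ∀ c, c ≠ 0 → 0 < F c := by
    intro c hc
    let q : Polynomial ℝ := ∑ k : Fin n, Polynomial.C (c k) * Polynomial.X ^ (k : ℕ)
    have hq : q ≠ 0 := by
      intro h
      apply hc
      ext k
      have := congrArg (fun p : Polynomial ℝ => p.coeff k) h
      simpa [q, Polynomial.finsetSum_coeff, Polynomial.coeff_X_pow, Fin.val_inj] using this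
    have he : ∀ x, q.eval x = ∑ k, c k * x ^ (k : ℕ) := fun x => by
      simp [q, Polynomial.eval_finsetSum]
    simp only [F, ← he]
    refine intervalIntegral.integral_pos (by norm_num) (by fun_prop)
      (fun x _ => sq_nonneg _) ?_
    by_contra! h
    refine hq (Polynomial.eq_zero_of_infinite_isRoot q ?_)
    refine (Icc_infinite (zero_lt_one' ℝ)).mono fun x hx => ?_
    have := h x hx
    exact pow_eq_zero_iff (two_ne_zero) |>.1 (le_antisymm this (sq_nonneg _))
  have hsmul : ∀ (a : ℝ) c, F (a • c) = a ^ 2 * F c := by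
    intro a c
    simp only [F]
    rw [← intervalIntegral.integral_const_mul]
    refine intervalIntegral.integral_congr fun x _ => ?_
    simp only [PiLp.smul_apply, smul_eq_mul, mul_assoc, ← Finset.mul_sum, mul_pow]
  by_cases hne : (Metric.sphere (0 : EuclideanSpace ℝ (Fin n)) 1).Nonempty
  -- The minimum of `F` over the compact unit sphere is positive; homogeneity of degree two extends
  -- the bound to all vectors.
  · obtain ⟨c₀, hc₀, hmin⟩ := (isCompact_sphere (0 : EuclideanSpace ℝ (Fin n)) 1).exists_isMinOn
      hne hF.continuousOn
    have h₀ : 0 < F c₀ := hpos c₀ fun h => by simp [h] at hc₀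
    refine ⟨(F c₀)⁻¹, inv_pos.2 h₀, fun c => ?_⟩
    by_cases hc : c = 0
    · subst hc
      simp
    have hn : 0 < ‖c‖ := norm_pos_iff.2 hc
    have h1 : F c₀ ≤ F (‖c‖⁻¹ • c) := hmin (by simp [norm_smul, hn.ne'])
    rw [hsmul] at h1
    change ‖c‖ ^ 2 ≤ (F c₀)⁻¹ * F c
    rw [inv_mul_eq_div, le_div_iff₀ h₀]
    calc ‖c‖ ^ 2 * F c₀ ≤ ‖c‖ ^ 2 * (‖c‖⁻¹ ^ 2 * F c) := by gcongr
      _ = F c := by field_simp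
  -- An empty sphere leaves only the zero vector, so any constant works.
  · refine ⟨1, one_pos, fun c => ?_⟩
    have hc : c = 0 := by
      by_contra hc
      exact hne ⟨‖c‖⁻¹ • c, by simp [norm_smul, norm_ne_zero_iff.2 hc]⟩
    subst hc
    simp

/-- Values of `p` and of its derivative on `[0, 1]` are linear in the coefficients with bounded
weights, so Cauchy–Schwarz reduces both to the coefficient norm. -/
theorem exists_eval_sq_le (r : ℕ) : ∃ K : ℝ, 0 < K ∧ ∀ p : Polynomial ℝ, p.natDegree ≤ r →
    ∀ x ∈ Icc (0 : ℝ) 1, p.eval x ^ 2 ≤ K * ∫ y in (0 : ℝ)..1, p.eval y ^ 2 ∧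
      p.derivative.eval x ^ 2 ≤ K * ∫ y in (0 : ℝ)..1, p.eval y ^ 2 := by
  obtain ⟨K, hK, h⟩ := exists_sq_norm_coeff_le (r + 1)
  -- There are `r + 1` terms, with squared weights at most `1` for the value and `r ^ 2` for the
  -- derivative. The two constants are added so that one serves both bounds.
  refine ⟨((r + 1) * r ^ 2 + (r + 1)) * K, by positivity, fun p hp x hx => ?_⟩
  let c : EuclideanSpace ℝ (Fin (r + 1)) := WithLp.toLp 2 fun k => p.coeff k
  have he : ∀ y, p.eval y = ∑ k, c k * y ^ (k : ℕ) := fun y => by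
    rw [Polynomial.eval_eq_sum_range' (Nat.lt_succ_of_le hp), Finset.sum_range]
  have hd : ∀ y, p.derivative.eval y = ∑ k, c k * (k * y ^ ((k : ℕ) - 1)) := fun y => by
    rw [Polynomial.derivative_eval, Polynomial.sum_over_range' _ _ (r + 1) (Nat.lt_succ_of_le hp),
      Finset.sum_range]
    · simp [c, mul_assoc]
    · simp
  have hc : ‖c‖ ^ 2 ≤ K * ∫ y in (0 : ℝ)..1, p.eval y ^ 2 := by simpa only [he] using h c
  have hcs : ∀ (b : Fin (r + 1) → ℝ) (M : ℝ), (∀ k, b k ^ 2 ≤ M) →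
      (∑ k, c k * b k) ^ 2 ≤ ((r + 1) * M) * ‖c‖ ^ 2 := by
    intro b M hb
    refine (Finset.sum_mul_sq_le_sq_mul_sq _ _ _).trans ?_
    rw [EuclideanSpace.real_norm_sq_eq, mul_comm]
    gcongr
    refine (Finset.sum_le_card_nsmul _ _ M fun k _ => hb k).trans ?_
    simp
  have hpow : ∀ m : ℕ, 0 ≤ x ^ m ∧ x ^ m ≤ 1 := fun m =>
    ⟨pow_nonneg hx.1 m, pow_le_one₀ hx.1 hx.2⟩
  constructor
  · rw [he]
    refine (hcs _ 1 fun k => pow_le_one₀ (hpow _).1 (hpow _).2).trans ?_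
    rw [mul_assoc ((r + 1) * r ^ 2 + (r + 1) : ℝ)]
    gcongr
    nlinarith [show (0 : ℝ) ≤ (r + 1) * r ^ 2 by positivity]
  · rw [hd]
    refine (hcs _ (r ^ 2) fun k => ?_).trans ?_
    · have hk : ((k : ℕ) : ℝ) ≤ r := by exact_mod_cast Nat.le_of_lt_succ k.2
      have : (k : ℝ) * x ^ ((k : ℕ) - 1) ≤ r * 1 := by
        gcongr
        exacts [(hpow _).1, (hpow _).2]
      rw [mul_one] at this
      exact pow_le_pow_left₀ (mul_nonneg (Nat.cast_nonneg _) (hpow _).1) this 2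
    · rw [mul_assoc ((r + 1) * r ^ 2 + (r + 1) : ℝ)]
      gcongr
      linarith

/-- Scaled inverse estimates for univariate polynomials on an interval. -/
theorem exists_inverse_estimate_interval (r : ℕ) : ∃ K : ℝ, 0 < K ∧ ∀ p : Polynomial ℝ,
    p.natDegree ≤ r → ∀ a h : ℝ, 0 < h →
      (∀ y ∈ Icc a (a + h), h * p.eval y ^ 2 ≤ K * ∫ s in a..(a + h), p.eval s ^ 2) ∧
      h ^ 2 * (∫ s in a..(a + h), p.derivative.eval s ^ 2) ≤
        K * ∫ s in a..(a + h), p.eval s ^ 2 := by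
  obtain ⟨K, hK, H⟩ := exists_eval_sq_le r
  refine ⟨K, hK, fun p hp a h hh => ?_⟩
  -- Pull back to the unit interval; each derivative of `q` brings out a factor `h`.
  let q : Polynomial ℝ := p.comp (Polynomial.C h * Polynomial.X + Polynomial.C a)
  have hq : q.natDegree ≤ r := by
    refine Polynomial.natDegree_comp_le.trans ?_
    calc _ ≤ p.natDegree * 1 := by
          gcongr
          exact Polynomial.natDegree_linear_le
      _ ≤ r := by simpa using hp
  have hqe : ∀ x, q.eval x = p.eval (h * x + a) := fun x => by simp [q]
  have hqd : ∀ x, q.derivative.eval x = h * p.derivative.eval (h * x + a) := fun x => by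
    simp [q, Polynomial.derivative_comp]
  have hint : h * ∫ y in (0 : ℝ)..1, q.eval y ^ 2 = ∫ s in a..(a + h), p.eval s ^ 2 := by
    simp only [hqe]
    have := intervalIntegral.mul_integral_comp_mul_add (a := 0) (b := 1)
      (f := fun s => p.eval s ^ 2) h a
    rw [this]
    congr 1 <;> ring
  have hpt : ∀ y ∈ Icc a (a + h), (y - a) / h ∈ Icc (0 : ℝ) 1 ∧ h * ((y - a) / h) + a = y := by
    intro y hy
    refine ⟨⟨div_nonneg (by linarith [hy.1]) hh.le, ?_⟩, by field_simp; ring⟩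
    rw [div_le_one hh]
    linarith [hy.2]
  constructor
  · intro y hy
    obtain ⟨h1, h2⟩ := hpt y hy
    have := (H q hq _ h1).1
    rw [hqe, h2] at this
    calc h * p.eval y ^ 2 ≤ h * (K * ∫ y in (0 : ℝ)..1, q.eval y ^ 2) := by gcongr
      _ = _ := by rw [← hint]; ring
  · have hder : ∀ y ∈ Icc a (a + h),
        h ^ 2 * p.derivative.eval y ^ 2 ≤ K * ∫ y in (0 : ℝ)..1, q.eval y ^ 2 := by
      intro y hy
      obtain ⟨h1, h2⟩ := hpt y hy
      have := (H q hq _ h1).2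
      rw [hqd, h2] at this
      linarith [mul_pow h (p.derivative.eval y) 2]
    rw [← intervalIntegral.integral_const_mul]
    calc _ ≤ ∫ _ in a..(a + h), K * ∫ y in (0 : ℝ)..1, q.eval y ^ 2 := by
          refine intervalIntegral.integral_mono_on (by linarith)
            (Continuous.intervalIntegrable (by fun_prop) _ _) (by simp) hder
      _ = _ := by
          rw [intervalIntegral.integral_const, ← hint, smul_eq_mul]
          ring

/-! ### Squares, and integration over them -/

namespace Grid

variable (G : Grid)

theorem len_pos (τ : Cell) : 0 < G.len τ := div_pos G.size_pos (by positivity)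

theorem pt_mem_cell {τ : Cell} {i : Fin 2} {s t : ℝ} :
    pt i s t ∈ G.cell τ ↔ s ∈ Ioo (G.corner τ i) (G.corner τ i + G.len τ) ∧
      t ∈ Ioo (G.corner τ (1 - i)) (G.corner τ (1 - i) + G.len τ) := by
  rw [cell, mem_ofPred_eq, forall_fin_two_iff i]
  simp

theorem pt_mem_closedCell {τ : Cell} {i : Fin 2} {s t : ℝ} :
    pt i s t ∈ G.closedCell τ ↔ s ∈ Icc (G.corner τ i) (G.corner τ i + G.len τ) ∧
      t ∈ Icc (G.corner τ (1 - i)) (G.corner τ (1 - i) + G.len τ) := by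
  rw [closedCell, mem_ofPred_eq, forall_fin_two_iff i]
  simp

theorem isOpen_cell (τ : Cell) : IsOpen (G.cell τ) := by
  simp only [cell, ofPred_forall, ofPred_and]
  refine isOpen_iInter_of_finite fun i => ?_
  exact (isOpen_lt (by fun_prop) (by fun_prop)).inter (isOpen_lt (by fun_prop) (by fun_prop))

theorem isClosed_closedCell (τ : Cell) : IsClosed (G.closedCell τ) := by
  simp only [closedCell, ofPred_forall, ofPred_and]
  refine isClosed_iInter fun i => ?_
  exact (isClosed_le (by fun_prop) (by fun_prop)).inter (isClosed_le (by fun_prop) (by fun_prop))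

theorem cell_subset_closedCell (τ : Cell) : G.cell τ ⊆ G.closedCell τ :=
  fun _ hx i => ⟨(hx i).1.le, (hx i).2.le⟩

theorem measurableSet_cell (τ : Cell) : MeasurableSet (G.cell τ) := (G.isOpen_cell τ).measurableSet

theorem dist_le_of_mem_closedCell {τ : Cell} {x y : Plane} (hx : x ∈ G.closedCell τ)
    (hy : y ∈ G.closedCell τ) : dist x y ≤ √2 * G.len τ := by
  rw [EuclideanSpace.dist_eq]
  refine Real.sqrt_le_iff.2 ⟨by have := G.len_pos τ; positivity, ?_⟩
  rw [mul_pow, Real.sq_sqrt zero_le_two, Fin.sum_univ_two]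
  have : ∀ i, dist (x i) (y i) ^ 2 ≤ G.len τ ^ 2 := fun i => by
    rw [Real.dist_eq, sq_abs]
    have h1 := hx i
    have h2 := hy i
    exact sq_le_sq' (by linarith) (by linarith)
  linarith [this 0, this 1]

theorem isCompact_closedCell (τ : Cell) : IsCompact (G.closedCell τ) :=
  Metric.isCompact_of_isClosed_isBounded (G.isClosed_closedCell τ)
    (Metric.isBounded_iff.2 ⟨_, fun _ hx _ hy => G.dist_le_of_mem_closedCell hx hy⟩)

theorem integrableOn_cell_of_continuous {F : Plane → ℝ} (hF : Continuous F) (τ : Cell) :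
    IntegrableOn F (G.cell τ) :=
  (hF.continuousOn.integrableOn_compact (G.isCompact_closedCell τ)).mono_set
    (G.cell_subset_closedCell τ)

theorem setIntegral_cell {F : Plane → ℝ} (hF : Continuous F) (τ : Cell) (i : Fin 2) :
    ∫ x in G.cell τ, F x =
      ∫ t in (G.corner τ (1 - i))..(G.corner τ (1 - i) + G.len τ),
        ∫ s in (G.corner τ i)..(G.corner τ i + G.len τ), F (pt i s t) := by
  have hl := G.len_pos τ
  have hpre : (fun z : ℝ × ℝ => pt i z.1 z.2) ⁻¹' G.cell τ =
      Ioo (G.corner τ i) (G.corner τ i + G.len τ) ×ˢ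
        Ioo (G.corner τ (1 - i)) (G.corner τ (1 - i) + G.len τ) := by
    ext z
    simp only [mem_preimage, pt_mem_cell, mem_prod]
  have h1 := (measurePreserving_pt i).setIntegral_preimage_emb (measurableEmbedding_pt i) F
    (G.cell τ)
  have hint : IntegrableOn (fun z : ℝ × ℝ => F (pt i z.1 z.2))
      (Ioo (G.corner τ i) (G.corner τ i + G.len τ) ×ˢ
        Ioo (G.corner τ (1 - i)) (G.corner τ (1 - i) + G.len τ)) := by
    rw [← hpre]
    exact ((measurePreserving_pt i).integrableOn_comp_preimage (measurableEmbedding_pt i)).2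
      (G.integrableOn_cell_of_continuous hF τ)
  rw [← h1, hpre, Measure.volume_eq_prod, ← Measure.prod_restrict]
  rw [Measure.volume_eq_prod, IntegrableOn, ← Measure.prod_restrict] at hint
  rw [integral_prod_symm _ hint, intervalIntegral.integral_of_le (by linarith),
    integral_Ioc_eq_integral_Ioo]
  refine integral_congr_ae (Eventually.of_forall fun t => ?_)
  simp only
  rw [intervalIntegral.integral_of_le (by linarith), integral_Ioc_eq_integral_Ioo]

theorem continuous_lineIntegral {F : Plane → ℝ} (hF : Continuous F) (i : Fin 2) (a b : ℝ) :
    Continuous fun t => ∫ s in a..b, F (pt i s t) := by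
  refine intervalIntegral.continuous_parametric_intervalIntegral_of_continuous' ?_ a b
  exact hF.comp ((continuous_pt i).comp continuous_swap)

/-- The normal coordinate of the line carrying the side `e` of `τ`. -/
def sideCoord (τ : Cell) (e : Side) : ℝ := G.corner τ e.1 + if e.2 then G.len τ else 0

theorem sidePoint_eq_pt (τ : Cell) (e : Side) (t : ℝ) :
    G.sidePoint τ e t = pt e.1 (G.sideCoord τ e) t := rfl

theorem sideCoord_mem_Icc (τ : Cell) (e : Side) :
    G.sideCoord τ e ∈ Icc (G.corner τ e.1) (G.corner τ e.1 + G.len τ) := by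
  have := G.len_pos τ
  unfold sideCoord
  split_ifs <;> constructor <;> linarith

end Grid

/-! ### Inverse and trace estimates on a square -/

/-- Inverse estimates and trace inequalities for polynomials on a square cell. -/
theorem exists_inverse_estimate_cell (r : ℕ) : ∃ K : ℝ, 0 < K ∧ ∀ p : MvPolynomial (Fin 2) ℝ,
    p ∈ MvPolynomial.restrictDegree (Fin 2) ℝ r → ∀ (G : Grid) (τ : Cell),
      (∀ i, G.len τ ^ 2 * (∫ x in G.cell τ, polyFun (MvPolynomial.pderiv i p) x ^ 2) ≤
        K * ∫ x in G.cell τ, polyFun p x ^ 2) ∧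
      ∀ e, G.len τ * G.sideL2Sq τ e (polyFun p) ≤ K * ∫ x in G.cell τ, polyFun p x ^ 2 := by
  obtain ⟨K, hK, H⟩ := exists_inverse_estimate_interval r
  refine ⟨K, hK, fun p hp G τ => ?_⟩
  have hl := G.len_pos τ
  have hc : Continuous fun x => polyFun p x ^ 2 := (continuous_polyFun p).pow 2
  constructor
  · intro i
    have hc' : Continuous fun x => polyFun (MvPolynomial.pderiv i p) x ^ 2 :=
      (continuous_polyFun _).pow 2
    rw [G.setIntegral_cell hc τ i, G.setIntegral_cell hc' τ i,
      ← intervalIntegral.integral_const_mul, ← intervalIntegral.integral_const_mul]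
    refine intervalIntegral.integral_mono_on (by linarith)
      ((continuous_const.mul (Grid.continuous_lineIntegral hc' i _ _)).intervalIntegrable _ _)
      ((continuous_const.mul (Grid.continuous_lineIntegral hc i _ _)).intervalIntegrable _ _)
      fun t _ => ?_
    obtain ⟨q, hq, hqe, hqd⟩ := exists_polynomial_line hp i t
    simp only [hqe, hqd]
    exact (H q hq _ _ hl).2
  · intro e
    rw [G.setIntegral_cell hc τ e.1, Grid.sideL2Sq,
      ← intervalIntegral.integral_const_mul, ← intervalIntegral.integral_const_mul]
    refine intervalIntegral.integral_mono_on (by linarith)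
      (Continuous.intervalIntegrable (continuous_const.mul (hc.comp ?_)) _ _)
      ((continuous_const.mul (Grid.continuous_lineIntegral hc e.1 _ _)).intervalIntegrable _ _)
      fun t _ => ?_
    · exact (continuous_pt e.1).comp (continuous_const.prodMk continuous_id)
    obtain ⟨q, hq, hqe, -⟩ := exists_polynomial_line hp e.1 t
    simp only [hqe, G.sidePoint_eq_pt]
    exact (H q hq _ _ hl).1 _ (G.sideCoord_mem_Icc τ e)

/-! ### Sides, normals and diameters -/

/-- The side of a square opposite to `e`. -/
def Side.opp (e : Side) : Side := (e.1, !e.2)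

theorem pt_add_smul_normal (e : Side) (z t s : ℝ) :
    pt e.1 z t + s • normal e = pt e.1 (z + if e.2 then s else -s) t := by
  refine PiLp.ext ?_
  rw [forall_fin_two_iff e.1]
  constructor
  · simp [normal]
  · simp [normal, one_sub_ne]

theorem normal_opp (e : Side) : normal e.opp = -normal e := by
  rcases e with ⟨i, b⟩
  refine PiLp.ext fun j => ?_
  cases b <;> by_cases h : j = i <;> simp [normal, Side.opp, h]

theorem dist_pt_pt (i : Fin 2) (z t z' t' : ℝ) :
    dist (pt i z t) (pt i z' t') = √((z - z') ^ 2 + (t - t') ^ 2) := by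
  rw [EuclideanSpace.dist_eq, Fin.sum_univ_two]
  fin_cases i <;> simp [pt, Real.dist_eq, sq_abs, add_comm]

namespace Grid

variable (G : Grid)

/-- The range of the tangential coordinate on the side `e` of `τ`. -/
def sideIoo (τ : Cell) (e : Side) : Set ℝ :=
  Ioo (G.corner τ (1 - e.1)) (G.corner τ (1 - e.1) + G.len τ)

theorem sideCoord_opp (τ : Cell) (e : Side) :
    G.sideCoord τ e.opp = G.corner τ e.1 + if e.2 then 0 else G.len τ := by
  rcases e with ⟨i, b⟩
  cases b <;> simp [sideCoord, Side.opp]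

theorem diam_side (τ : Cell) (e : Side) : Metric.diam (G.side τ e) = G.len τ := by
  have hi : Isometry (G.sidePoint τ e) := Isometry.of_dist_eq fun t t' => by
    rw [sidePoint_eq_pt, sidePoint_eq_pt, dist_pt_pt]
    simp [Real.sqrt_sq_eq_abs, Real.dist_eq]
  rw [side, hi.diam_image, Real.diam_Ioo (by linarith [G.len_pos τ])]
  ring

theorem isBounded_cell (τ : Cell) : Bornology.IsBounded (G.cell τ) :=
  (G.isCompact_closedCell τ).isBounded.subset (G.cell_subset_closedCell τ)

theorem diam_cell (τ : Cell) : Metric.diam (G.cell τ) = √2 * G.len τ := by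
  have hl := G.len_pos τ
  refine le_antisymm (Metric.diam_le_of_forall_dist_le (by positivity) fun x hx y hy =>
    G.dist_le_of_mem_closedCell (G.cell_subset_closedCell τ hx) (G.cell_subset_closedCell τ hy)) ?_
  -- The cell is open and does not contain its corners, so the diagonal is approached by points at
  -- relative distance `u` inside two opposite corners, with `u → 0`.
  have h : ∀ u ∈ Ioo (0 : ℝ) (1 / 2),
      √2 * ((1 - 2 * u) * G.len τ) ≤ Metric.diam (G.cell τ) := by
    rintro u ⟨hu0, hu1⟩
    have h1 : 0 < u * G.len τ := by positivity
    have h2 : 0 ≤ (1 - 2 * u) * G.len τ := mul_nonneg (by linarith) hl.le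
    have hd := Metric.dist_le_diam_of_mem (G.isBounded_cell τ)
      (G.pt_mem_cell (i := 0) (s := G.corner τ 0 + G.len τ - u * G.len τ)
        (t := G.corner τ (1 - 0) + G.len τ - u * G.len τ) |>.2
        ⟨⟨by linarith, by linarith⟩, ⟨by linarith, by linarith⟩⟩)
      (G.pt_mem_cell (i := 0) (s := G.corner τ 0 + u * G.len τ)
        (t := G.corner τ (1 - 0) + u * G.len τ) |>.2
        ⟨⟨by linarith, by linarith⟩, ⟨by linarith, by linarith⟩⟩)
    rw [dist_pt_pt] at hd
    refine le_of_eq_of_le ?_ hd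
    rw [← Real.sqrt_sq h2, ← Real.sqrt_mul zero_le_two]
    congr 1
    ring
  have ht : Tendsto (fun u : ℝ => √2 * ((1 - 2 * u) * G.len τ)) (𝓝[>] 0)
      (𝓝 (√2 * ((1 - 2 * 0) * G.len τ))) :=
    (Continuous.tendsto (by fun_prop) 0).mono_left nhdsWithin_le_nhds
  simp only [mul_zero, sub_zero, one_mul] at ht
  exact le_of_tendsto ht (by
    filter_upwards [Ioo_mem_nhdsGT (show (0 : ℝ) < 1 / 2 by norm_num)] with u hu using h u hu)

theorem nonempty_cell (τ : Cell) : (G.cell τ).Nonempty := by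
  have hl := G.len_pos τ
  exact ⟨pt 0 (G.corner τ 0 + G.len τ / 2) (G.corner τ (1 - 0) + G.len τ / 2),
    G.pt_mem_cell.2 ⟨⟨by linarith, by linarith⟩, ⟨by linarith, by linarith⟩⟩⟩

/-- The points on the inner side of a side of a cell belong to the cell. -/
theorem eventually_sub_normal_mem_cell {τ : Cell} {e : Side} {t : ℝ} (ht : t ∈ G.sideIoo τ e) :
    ∀ᶠ s in 𝓝[>] (0 : ℝ), G.sidePoint τ e t - s • normal e ∈ G.cell τ := by
  have hl := G.len_pos τ
  filter_upwards [Ioo_mem_nhdsGT hl] with s hs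
  rw [sub_eq_add_neg, ← neg_smul, sidePoint_eq_pt, pt_add_smul_normal, pt_mem_cell]
  refine ⟨?_, ht⟩
  unfold sideCoord
  cases e.2 <;> simp <;> constructor <;> linarith [hs.1, hs.2]

theorem eventually_add_normal_mem_cell {τ τ' : Cell} {e : Side} {t : ℝ}
    (ht : t ∈ G.sideIoo τ' e) (hz : G.sideCoord τ' e.opp = G.sideCoord τ e) :
    ∀ᶠ s in 𝓝[>] (0 : ℝ), G.sidePoint τ e t + s • normal e ∈ G.cell τ' := by
  have h := G.eventually_sub_normal_mem_cell (τ := τ') (e := e.opp) ht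
  rw [normal_opp, sidePoint_eq_pt, hz] at h
  simp only [smul_neg, sub_neg_eq_add] at h
  exact h

/-! ### Nesting of dyadic cells -/

/-- Dyadic intervals that meet are nested. -/
theorem corner_le_of_level_le {τ τ' : Cell} {i : Fin 2} {t : ℝ} (hlev : τ.1 ≤ τ'.1)
    (ht : t ∈ Ioo (G.corner τ i) (G.corner τ i + G.len τ))
    (ht' : t ∈ Ioo (G.corner τ' i) (G.corner τ' i + G.len τ')) :
    G.corner τ i ≤ G.corner τ' i ∧ G.corner τ' i + G.len τ' ≤ G.corner τ i + G.len τ := by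
  obtain ⟨d, hd⟩ := Nat.exists_eq_add_of_le hlev
  have hL := G.len_pos τ'
  have hlen : G.len τ = 2 ^ d * G.len τ' := by
    simp only [len, hd, pow_add]
    field_simp
  simp only [corner, hlen, mem_Ioo] at *
  set L := G.len τ'
  have h1 : (2 : ℝ) ^ d * (τ.2 i) < (τ'.2 i) + 1 := by
    refine lt_of_mul_lt_mul_left ?_ hL.le
    nlinarith
  have h2 : (τ'.2 i : ℝ) < 2 ^ d * (τ.2 i) + 2 ^ d := by
    refine lt_of_mul_lt_mul_left ?_ hL.le
    nlinarith
  -- The indices are integers, so a strict inequality gains a full unit. This turns mere overlap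
  -- into containment.
  have h1' : (2 : ℤ) ^ d * τ.2 i ≤ τ'.2 i := by
    have : (2 : ℤ) ^ d * τ.2 i < τ'.2 i + 1 := by exact_mod_cast h1
    lia
  have h2' : τ'.2 i + 1 ≤ (2 : ℤ) ^ d * τ.2 i + 2 ^ d := by exact_mod_cast h2
  have h1'' : (2 : ℝ) ^ d * τ.2 i ≤ τ'.2 i := by exact_mod_cast h1'
  have h2'' : (τ'.2 i : ℝ) + 1 ≤ 2 ^ d * τ.2 i + 2 ^ d := by exact_mod_cast h2'
  constructor <;> nlinarith

theorem len_le_of_level_le {τ τ' : Cell} (h : τ.1 ≤ τ'.1) : G.len τ' ≤ G.len τ := by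
  unfold len
  have := G.size_pos
  gcongr
  norm_num

theorem corner_le_of_cell_subset {τ τ' : Cell} (h : G.cell τ' ⊆ G.cell τ) (i : Fin 2) :
    G.corner τ i ≤ G.corner τ' i ∧ G.corner τ' i + G.len τ' ≤ G.corner τ i + G.len τ := by
  have hl := G.len_pos τ'
  have hs : Ioo (G.corner τ' i) (G.corner τ' i + G.len τ') ⊆
      Ioo (G.corner τ i) (G.corner τ i + G.len τ) := by
    intro s hs
    have hm : pt i s (G.corner τ' (1 - i) + G.len τ' / 2) ∈ G.cell τ' :=
      G.pt_mem_cell.2 ⟨hs, ⟨by linarith, by linarith⟩⟩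
    exact (G.pt_mem_cell.1 (h hm)).1
  exact (Ioo_subset_Ioo_iff (by linarith)).1 hs

theorem len_le_of_cell_subset {τ τ' : Cell} (h : G.cell τ' ⊆ G.cell τ) : G.len τ' ≤ G.len τ := by
  have := G.corner_le_of_cell_subset h 0
  linarith

/-- A cell that is properly contained in another one has at most half its side length. -/
theorem len_le_half_of_cell_subset {τ τ' : Cell} (h : G.cell τ' ⊆ G.cell τ) (hne : τ' ≠ τ) :
    G.len τ' ≤ 1 / 2 * G.len τ := by
  have hlt : τ.1 < τ'.1 := by
    by_contra! hle
    have h1 := G.len_le_of_level_le hle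
    apply hne
    have hL : G.len τ' = G.len τ := le_antisymm (G.len_le_of_cell_subset h) h1
    have hlev : τ'.1 = τ.1 := by
      simp only [len] at hL
      rw [div_eq_div_iff (by positivity) (by positivity)] at hL
      have h2 := mul_left_cancel₀ G.size_pos.ne' hL.symm
      exact Nat.pow_right_injective le_rfl (by exact_mod_cast h2)
    refine Prod.ext hlev (funext fun i => ?_)
    have h3 := G.corner_le_of_cell_subset h i
    have h4 : G.corner τ' i = G.corner τ i := by linarith
    simp only [corner, hL, add_right_inj] at h4
    exact_mod_cast mul_left_cancel₀ (G.len_pos τ).ne' h4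
  have h5 := G.len_le_of_level_le (τ := (τ.1 + 1, τ.2)) (τ' := τ') hlt
  refine h5.trans (le_of_eq ?_)
  simp only [len, pow_succ]
  field_simp

/-! ### Partitions and neighbouring cells -/

theorem closure_domain_subset (Q : Finset (Fin 2 → ℤ)) :
    closure (G.domain Q) ⊆ ⋃ k ∈ Q, G.closedCell (0, k) := by
  refine closure_minimal interior_subset ?_
  exact isClosed_biUnion_finset fun k _ => G.isClosed_closedCell _

variable {G} {Q : Finset (Fin 2 → ℤ)} {P : Finset Cell}

theorem IsPartition.cell_subset_domain (hP : G.IsPartition Q P) {τ : Cell} (hτ : τ ∈ P) :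
    G.cell τ ⊆ G.domain Q := by
  refine interior_maximal ?_ (G.isOpen_cell τ)
  refine (G.cell_subset_closedCell τ).trans (Subset.trans ?_ (G.closure_domain_subset Q))
  rw [← hP.2]
  exact subset_biUnion_of_mem (u := fun τ => G.closedCell τ) hτ

theorem IsPartition.eq_of_mem_cell (hP : G.IsPartition Q P) {τ τ' : Cell} (hτ : τ ∈ P)
    (hτ' : τ' ∈ P) {x : Plane} (hx : x ∈ G.cell τ) (hx' : x ∈ G.cell τ') : τ = τ' := by
  by_contra h
  exact Set.disjoint_left.1 (hP.1 hτ hτ' h) hx hx'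

/-- Two cells of a partition with sides of the same orientation on a common line have disjoint
sides. -/
theorem IsPartition.eq_of_mem_sideIoo (hP : G.IsPartition Q P) {τ τ' : Cell} (hτ : τ ∈ P)
    (hτ' : τ' ∈ P) {e : Side} (hz : G.sideCoord τ e = G.sideCoord τ' e) {t : ℝ}
    (ht : t ∈ G.sideIoo τ e) (ht' : t ∈ G.sideIoo τ' e) : τ = τ' := by
  have h1 := G.eventually_sub_normal_mem_cell ht
  have h2 := G.eventually_sub_normal_mem_cell ht'
  rw [sidePoint_eq_pt, hz, ← sidePoint_eq_pt] at h1
  obtain ⟨s, hs, hs'⟩ := (h1.and h2).exists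
  exact hP.eq_of_mem_cell hτ hτ' hs hs'

/-- Translates coincidence of coordinates into the frontier condition used by the mesh grading part
of `ShapeRegular`. -/
theorem side_subset_frontier {τ τ' : Cell} {e e' : Side} (he : e'.1 = e.1)
    (hz : G.sideCoord τ' e' = G.sideCoord τ e)
    (hI : G.sideIoo τ' e' ⊆ G.sideIoo τ e) : G.side τ' e' ⊆ frontier (G.cell τ) := by
  rintro _ ⟨t, ht, rfl⟩
  have ht' : t ∈ G.sideIoo τ e := hI ht
  rw [(G.isOpen_cell τ).frontier_eq, sidePoint_eq_pt, hz, he, ← sidePoint_eq_pt]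
  constructor
  · have hlim : Tendsto (fun s : ℝ => G.sidePoint τ e t - s • normal e) (𝓝[>] 0)
        (𝓝 (G.sidePoint τ e t - (0 : ℝ) • normal e)) :=
      (Continuous.tendsto (by fun_prop) 0).mono_left nhdsWithin_le_nhds
    rw [zero_smul, sub_zero] at hlim
    exact mem_closure_of_tendsto hlim (G.eventually_sub_normal_mem_cell ht')
  · intro h
    rw [sidePoint_eq_pt, pt_mem_cell] at h
    have h1 := h.1
    unfold sideCoord at h1
    split_ifs at h1
    · exact lt_irrefl _ h1.2
    · simp at h1

/-- Neighbouring cells of a shape regular partition have comparable size. -/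
theorem ShapeRegular.len_le {B : Finset (Plane → ℝ)} {c : ℝ} (hS : G.ShapeRegular P B c)
    {τ τ' : Cell} (hτ : τ ∈ P) (hτ' : τ' ∈ P) {e : Side}
    (hz : G.sideCoord τ' e.opp = G.sideCoord τ e) {t : ℝ} (ht : t ∈ G.sideIoo τ e)
    (ht' : t ∈ G.sideIoo τ' e) : G.len τ ≤ max 1 c * G.len τ' := by
  have hl := G.len_pos τ
  have hl' := G.len_pos τ'
  -- If the neighbour is at least as fine, its whole side lies in the side of `τ` and mesh grading
  -- gives `c`. Otherwise levels alone give `1`. Hence `max 1 c`.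
  rcases le_total τ.1 τ'.1 with h | h
  · have hI := G.corner_le_of_level_le h ht ht'
    have hd := hS.2.1 τ hτ τ' hτ' e.opp
      (side_subset_frontier (e := e) rfl hz (Ioo_subset_Ioo hI.1 hI.2))
    rw [diam_cell, diam_side] at hd
    calc G.len τ ≤ √2 * G.len τ := le_mul_of_one_le_left hl.le (by simp)
      _ ≤ c * G.len τ' := hd
      _ ≤ _ := by gcongr; exact le_max_right _ _
  · calc G.len τ ≤ 1 * G.len τ' := by rw [one_mul]; exact G.len_le_of_level_le h
      _ ≤ _ := by gcongr; exact le_max_left _ _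

/-- Across almost every point of an interior side of a cell there is exactly one neighbour. -/
theorem IsPartition.exists_neighbour (hP : G.IsPartition Q P) {τ : Cell} (hτ : τ ∈ P) {e : Side}
    (he : G.side τ e ⊆ G.domain Q) :
    ∀ᵐ t ∂(volume.restrict (G.sideIoo τ e)), ∃ τ' ∈ P, t ∈ G.sideIoo τ' e ∧
      G.sideCoord τ' e.opp = G.sideCoord τ e := by
  -- The exceptional points are the endpoints of all cells in the tangential direction. Away from
  -- them, lying in a closed cell puts `t` in an open side interval.
  let E : Set ℝ := ⋃ τ' ∈ P, {G.corner τ' (1 - e.1), G.corner τ' (1 - e.1) + G.len τ'}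
  have hE : E.Finite := P.finite_toSet.biUnion fun _ _ => by simp
  have hnull : ∀ᵐ t ∂(volume.restrict (G.sideIoo τ e)), t ∉ E :=
    measure_eq_zero_iff_ae_notMem.1 (hE.measure_zero _)
  filter_upwards [hnull, ae_restrict_mem measurableSet_Ioo] with t htE ht
  have hx : G.sidePoint τ e t ∈ G.domain Q := he ⟨t, ht, rfl⟩
  have hlim : Tendsto (fun s : ℝ => G.sidePoint τ e t + s • normal e) (𝓝[>] 0)
      (𝓝 (G.sidePoint τ e t + (0 : ℝ) • normal e)) :=
    (Continuous.tendsto (by fun_prop) 0).mono_left nhdsWithin_le_nhds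
  rw [zero_smul, add_zero] at hlim
  have hev : ∀ᶠ s in 𝓝[>] (0 : ℝ), G.sidePoint τ e t + s • normal e ∈ G.domain Q :=
    hlim (isOpen_interior.mem_nhds hx)
  -- Nearby outer points lie in the union of finitely many closed cells, so one of these cells
  -- contains points arbitrarily close to the side.
  obtain ⟨τ', hτ', hfr⟩ : ∃ τ' ∈ P, ∃ᶠ s in 𝓝[>] (0 : ℝ),
      G.sidePoint τ e t + s • normal e ∈ G.closedCell τ' := by
    by_contra h
    simp only [not_exists, not_and, not_frequently] at h
    have hall := (eventually_all_finset P).2 h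
    obtain ⟨s, hs1, hs2⟩ := (hall.and hev).exists
    have hc := subset_closure hs2
    rw [← hP.2, mem_iUnion₂] at hc
    obtain ⟨τ', hτ', hm⟩ := hc
    exact hs1 τ' hτ' hm
  have hl := G.len_pos τ
  have hl' := G.len_pos τ'
  have ht' : t ∈ G.sideIoo τ' e := by
    obtain ⟨s, hs⟩ := hfr.exists
    rw [sidePoint_eq_pt, pt_add_smul_normal, pt_mem_closedCell] at hs
    have hne : t ∉ ({G.corner τ' (1 - e.1), G.corner τ' (1 - e.1) + G.len τ'} : Set ℝ) :=
      fun h => htE (mem_biUnion hτ' h)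
    simp only [mem_insert_iff, mem_singleton_iff, not_or] at hne
    exact ⟨lt_of_le_of_ne hs.2.1 (Ne.symm hne.1), lt_of_le_of_ne hs.2.2 hne.2⟩
  refine ⟨τ', hτ', ht', ?_⟩
  have hpos : ∃ᶠ s in 𝓝[>] (0 : ℝ), 0 < s ∧
      (G.sideCoord τ e + if e.2 then s else -s) ∈
        Icc (G.corner τ' e.1) (G.corner τ' e.1 + G.len τ') := by
    refine (hfr.and_eventually self_mem_nhdsWithin).mono fun s hs => ⟨hs.2, ?_⟩
    have h := hs.1
    rw [sidePoint_eq_pt, pt_add_smul_normal, pt_mem_closedCell] at h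
    exact h.1
  -- Were the side point interior to `τ'`, points just inside `τ` would lie in both cells, forcing
  -- `τ' = τ`; but a side of `τ` is not interior to `τ`.
  have hin : ¬ G.sideCoord τ e ∈ Ioo (G.corner τ' e.1) (G.corner τ' e.1 + G.len τ') := by
    intro h
    have h1 : G.sidePoint τ e t ∈ G.cell τ' := G.pt_mem_cell.2 ⟨h, ht'⟩
    have hlim' : Tendsto (fun s : ℝ => G.sidePoint τ e t - s • normal e) (𝓝[>] 0)
        (𝓝 (G.sidePoint τ e t - (0 : ℝ) • normal e)) :=
      (Continuous.tendsto (by fun_prop) 0).mono_left nhdsWithin_le_nhds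
    rw [zero_smul, sub_zero] at hlim'
    obtain ⟨s, hs1, hs2⟩ := ((hlim'.eventually ((G.isOpen_cell τ').mem_nhds h1)).and
      (G.eventually_sub_normal_mem_cell ht)).exists
    have heq := hP.eq_of_mem_cell hτ' hτ hs1 hs2
    subst heq
    unfold sideCoord at h
    split_ifs at h
    · exact lt_irrefl _ h.2
    · simp at h
  rw [sideCoord_opp]
  -- The side coordinate is a limit of coordinates in the closed interval of `τ'` but is not in the
  -- open one, so it is an endpoint; the direction of approach decides which.
  cases hb : e.2
  · simp only [hb, Bool.false_eq_true, ↓reduceIte] at hpos hin ⊢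
    obtain ⟨s, hs0, hs⟩ := hpos.exists
    have h1 : G.sideCoord τ e ≤ G.corner τ' e.1 + G.len τ' := by
      by_contra! h
      obtain ⟨u, ⟨-, hu⟩, hu'⟩ := ((hpos.and_eventually (Ioo_mem_nhdsGT (sub_pos.2 h)))).exists
      linarith [hu'.2, hu.1, hu.2]
    by_contra hne
    exact hin ⟨by linarith [hs.1], lt_of_le_of_ne h1 (Ne.symm hne)⟩
  · simp only [hb, ↓reduceIte, add_zero] at hpos hin ⊢
    obtain ⟨s, hs0, hs⟩ := hpos.exists
    have h1 : G.corner τ' e.1 ≤ G.sideCoord τ e := by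
      by_contra! h
      obtain ⟨u, ⟨-, hu⟩, hu'⟩ := ((hpos.and_eventually (Ioo_mem_nhdsGT (sub_pos.2 h)))).exists
      linarith [hu'.2, hu.1, hu.2]
    by_contra hne
    exact hin ⟨lt_of_le_of_ne h1 hne, by linarith [hs.2]⟩

/-- If a part of a side of a cell is interior to the domain, so is the whole side. -/
theorem side_subset_domain {τ τ' : Cell} (h : G.cell τ' ⊆ G.cell τ) {e : Side}
    (hz : G.sideCoord τ' e = G.sideCoord τ e) (he : G.side τ' e ⊆ G.domain Q) :
    G.side τ e ⊆ G.domain Q := by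
  have hl' := G.len_pos τ'
  have hs := G.size_pos
  set j := 1 - e.1 with hj
  -- The index of the strip of initial squares that contains the tangential range of `τ`. The domain
  -- is a union of initial squares, so translation along the side within this strip preserves
  -- membership.
  let m : ℤ := τ.2 j / 2 ^ τ.1
  let a : ℝ := G.origin j + G.size * m
  have hI : Ioo (G.corner τ j) (G.corner τ j + G.len τ) ⊆ Ioo a (a + G.size) := by
    have hp : (0 : ℤ) < 2 ^ τ.1 := by positivity
    have h1 : m * 2 ^ τ.1 ≤ τ.2 j := Int.ediv_mul_le _ hp.ne'
    have h2 : τ.2 j + 1 ≤ (m + 1) * 2 ^ τ.1 := Int.lt_ediv_add_one_mul_self _ hp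
    have h1' : (m : ℝ) * 2 ^ τ.1 ≤ τ.2 j := by exact_mod_cast h1
    have h2' : (τ.2 j : ℝ) + 1 ≤ (m + 1) * 2 ^ τ.1 := by exact_mod_cast h2
    have hlen : G.size = 2 ^ τ.1 * G.len τ := by
      unfold len
      field_simp
    have hl := G.len_pos τ
    refine Ioo_subset_Ioo ?_ ?_ <;> simp only [a, corner] <;> rw [hlen] <;> nlinarith
  rintro _ ⟨t, ht, rfl⟩
  obtain ⟨t', ht'⟩ : (G.sideIoo τ' e).Nonempty := nonempty_Ioo.2 (by linarith)
  have hx' : G.sidePoint τ' e t' ∈ G.domain Q := he ⟨t', ht', rfl⟩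
  rw [sidePoint_eq_pt, hz, ← sidePoint_eq_pt] at hx'
  have hta : t ∈ Ioo a (a + G.size) := hI ht
  have hta' : t' ∈ Ioo a (a + G.size) := by
    have hc := G.corner_le_of_cell_subset h j
    exact hI (Ioo_subset_Ioo hc.1 hc.2 ht')
  rw [domain, mem_interior_iff_mem_nhds] at hx' ⊢
  have hcont : Continuous fun y : Plane => pt e.1 (y e.1) (y j + (t' - t)) :=
    (continuous_pt e.1).comp (Continuous.prodMk (by fun_prop) (by fun_prop))
  have hat : pt e.1 (G.sidePoint τ e t e.1) (G.sidePoint τ e t j + (t' - t)) =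
      G.sidePoint τ e t' := by
    simp [sidePoint_eq_pt, hj]
  have hn1 := hcont.continuousAt.preimage_mem_nhds (x := G.sidePoint τ e t) (by rwa [hat])
  have hj1 : Continuous fun y : Plane => y j := by fun_prop
  have hn2 : {y : Plane | y j ∈ Ioo a (a + G.size)} ∈ 𝓝 (G.sidePoint τ e t) :=
    hj1.continuousAt.preimage_mem_nhds (Ioo_mem_nhds (by simpa [sidePoint_eq_pt, hj] using hta.1)
      (by simpa [sidePoint_eq_pt, hj] using hta.2))
  have hj2 : Continuous fun y : Plane => y j + (t' - t) := by fun_prop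
  have hn3 : {y : Plane | y j + (t' - t) ∈ Ioo a (a + G.size)} ∈ 𝓝 (G.sidePoint τ e t) :=
    hj2.continuousAt.preimage_mem_nhds (Ioo_mem_nhds (by simpa [sidePoint_eq_pt, hj] using hta'.1)
      (by simpa [sidePoint_eq_pt, hj] using hta'.2))
  filter_upwards [hn1, hn2, hn3] with y hy1 hy2 hy3
  rw [mem_preimage, mem_iUnion₂] at hy1
  obtain ⟨k, hk, hy1⟩ := hy1
  refine mem_iUnion₂.2 ⟨k, hk, ?_⟩
  rw [pt_mem_closedCell] at hy1
  rw [← pt_self e.1 y, pt_mem_closedCell]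
  refine ⟨hy1.1, ?_⟩
  -- The translated point lies strictly inside the strip `m`, so the closed initial square
  -- containing it has that index and contains the original point too.
  have hkm : k j = m := by
    have h1 := hy1.2
    simp only [← hj, corner, len, pow_zero, div_one, mem_Icc] at h1
    simp only [mem_Ioo, a] at hy3
    have c1 : (k j : ℝ) < m + 1 := by
      refine lt_of_mul_lt_mul_left ?_ hs.le
      linarith
    have c2 : (m : ℝ) < k j + 1 := by
      refine lt_of_mul_lt_mul_left ?_ hs.le
      linarith
    have c1' : k j < m + 1 := by exact_mod_cast c1
    have c2' : m < k j + 1 := by exact_mod_cast c2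
    lia
  simp only [← hj, corner, len, pow_zero, div_one, hkm]
  exact ⟨hy2.1.le, hy2.2.le⟩

end Grid

/-! ### Integral inequalities and one-sided limits -/

theorem sum_setIntegral_le {α ι : Type*} [MeasurableSpace α] {μ : Measure α} (S : Finset ι)
    {A : ι → Set α} {T : Set α} {F : α → ℝ} (hA : ∀ i ∈ S, MeasurableSet (A i))
    (hd : (S : Set ι).PairwiseDisjoint A) (hAT : ∀ i ∈ S, A i ⊆ T) (hF : ∀ x, 0 ≤ F x)
    (hint : IntegrableOn F T μ) : ∑ i ∈ S, ∫ x in A i, F x ∂μ ≤ ∫ x in T, F x ∂μ := by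
  rw [← integral_biUnion_finset S hA hd fun i hi => hint.mono_set (hAT i hi)]
  exact setIntegral_mono_set hint (Eventually.of_forall hF)
    (LE.le.eventuallyLE (iUnion₂_subset hAT))

theorem integral_sq_le_young {α : Type*} [MeasurableSpace α] {μ : Measure α} {u v w : α → ℝ}
    (h : ∀ᵐ x ∂μ, u x = v x - w x) (hv : Integrable (fun x => v x ^ 2) μ)
    (hw : Integrable (fun x => w x ^ 2) μ) {δ : ℝ} (hδ : 0 < δ) :
    ∫ x, u x ^ 2 ∂μ ≤ (1 + δ) * (∫ x, v x ^ 2 ∂μ) + (1 + 1 / δ) * ∫ x, w x ^ 2 ∂μ := by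
  rw [← integral_const_mul, ← integral_const_mul,
    ← integral_add (hv.const_mul _) (hw.const_mul _)]
  refine integral_mono_of_nonneg (Eventually.of_forall fun x => sq_nonneg _)
    ((hv.const_mul _).add (hw.const_mul _)) ?_
  filter_upwards [h] with x hx
  rw [hx]
  -- Expanding this square bounds the cross term: `-2vw ≤ δ v² + w² / δ`.
  have h1 : 0 ≤ (δ * v x + w x) ^ 2 / δ := by positivity
  have h2 : (δ * v x + w x) ^ 2 / δ = δ * v x ^ 2 + 2 * (v x * w x) + 1 / δ * w x ^ 2 := by
    field_simp
    ring
  nlinarith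

theorem limUnder_eq_polyFun {U : Set Plane} {g : Plane → ℝ} {p : MvPolynomial (Fin 2) ℝ}
    (hg : EqOn g (polyFun p) U) {x n : Plane} (hx : ∀ᶠ s in 𝓝[>] (0 : ℝ), x + s • n ∈ U) :
    limUnder (𝓝[>] (0 : ℝ)) (fun s => g (x + s • n)) = polyFun p x := by
  refine Tendsto.limUnder_eq ?_
  have hlim : Tendsto (fun s : ℝ => polyFun p (x + s • n)) (𝓝[>] 0)
      (𝓝 (polyFun p (x + (0 : ℝ) • n))) :=
    (Continuous.tendsto ((continuous_polyFun p).comp (by fun_prop)) 0).mono_left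
      nhdsWithin_le_nhds
  rw [zero_smul, add_zero] at hlim
  exact hlim.congr' (hx.mono fun s hs => (hg hs).symm)

theorem jump_eq_of_eventually_mem {U U' : Set Plane} {g : Plane → ℝ}
    {p p' : MvPolynomial (Fin 2) ℝ} (hg : EqOn g (polyFun p) U) (hg' : EqOn g (polyFun p') U')
    {x n : Plane} (hx : ∀ᶠ s in 𝓝[>] (0 : ℝ), x - s • n ∈ U)
    (hx' : ∀ᶠ s in 𝓝[>] (0 : ℝ), x + s • n ∈ U') :
    jump n g x = polyFun p' x - polyFun p x := by
  simp only [sub_eq_add_neg, ← smul_neg] at hx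
  have h := limUnder_eq_polyFun hg hx
  simp only [smul_neg, ← sub_eq_add_neg] at h
  rw [jump, limUnder_eq_polyFun hg' hx', h]

theorem jump_eq_zero {U : Set Plane} (hU : IsOpen U) {g : Plane → ℝ}
    {p : MvPolynomial (Fin 2) ℝ} (hg : EqOn g (polyFun p) U) {x n : Plane} (hx : x ∈ U) :
    jump n g x = 0 := by
  have hlim : ∀ m : Plane, ∀ᶠ s in 𝓝[>] (0 : ℝ), x + s • m ∈ U := fun m => by
    have h : Tendsto (fun s : ℝ => x + s • m) (𝓝[>] 0) (𝓝 (x + (0 : ℝ) • m)) :=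
      (Continuous.tendsto (by fun_prop) 0).mono_left nhdsWithin_le_nhds
    rw [zero_smul, add_zero] at h
    exact h (hU.mem_nhds hx)
  rw [jump_eq_of_eventually_mem hg hg (by simpa [sub_eq_add_neg] using hlim (-n)) (hlim n),
    sub_self]

/-! ### Jumps of piecewise polynomials -/

namespace Grid

/-- On every cell `τ` of `P` the function `g` agrees with the polynomial `p τ`. -/
def IsPiecewise (G : Grid) (P : Finset Cell) (p : Cell → MvPolynomial (Fin 2) ℝ)
    (g : Plane → ℝ) : Prop := ∀ τ ∈ P, EqOn g (polyFun (p τ)) (G.cell τ)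

variable {G : Grid} {Q : Finset (Fin 2 → ℤ)} {P Ps : Finset Cell} {g : Plane → ℝ}
  {p : Cell → MvPolynomial (Fin 2) ℝ}

theorem IsPiecewise.lap (h : G.IsPiecewise P p g) :
    G.IsPiecewise P (fun τ => lapPoly (p τ)) (lap g) :=
  fun τ hτ => lap_eq_of_eqOn (G.isOpen_cell τ) (h τ hτ)

theorem IsPiecewise.fderiv_normal (h : G.IsPiecewise P p g) (e : Side) :
    G.IsPiecewise P
      (fun τ => (if e.2 then (1 : ℝ) else -1) • MvPolynomial.pderiv e.1 (p τ))
      (fun y => fderiv ℝ g y (normal e)) :=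
  fun τ hτ => fderiv_single_eq_of_eqOn (G.isOpen_cell τ) (h τ hτ) _ _

theorem IsPiecewise.sub {q : Cell → MvPolynomial (Fin 2) ℝ} {k : Plane → ℝ}
    (h : G.IsPiecewise P p g) (h' : G.IsPiecewise P q k) :
    G.IsPiecewise P (fun τ => p τ - q τ) (g - k) := fun τ hτ x hx => by
  rw [polyFun_sub, Pi.sub_apply, h τ hτ hx, h' τ hτ hx]

theorem measurableSet_sideIoo (τ : Cell) (e : Side) : MeasurableSet (G.sideIoo τ e) :=
  measurableSet_Ioo

theorem sideL2Sq_eq_setIntegral (τ : Cell) (e : Side) (g : Plane → ℝ) :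
    G.sideL2Sq τ e g = ∫ t in G.sideIoo τ e, g (G.sidePoint τ e t) ^ 2 := by
  rw [sideL2Sq, intervalIntegral.integral_of_le (by linarith [G.len_pos τ]),
    integral_Ioc_eq_integral_Ioo, sideIoo]

theorem sideL2Sq_nonneg (τ : Cell) (e : Side) (g : Plane → ℝ) : 0 ≤ G.sideL2Sq τ e g := by
  rw [sideL2Sq_eq_setIntegral]
  exact integral_nonneg fun t => sq_nonneg _

theorem continuous_sidePoint (τ : Cell) (e : Side) : Continuous (G.sidePoint τ e) :=
  (continuous_pt e.1).comp (continuous_const.prodMk continuous_id)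

theorem integrableOn_sideIoo {F : ℝ → ℝ} (hF : Continuous F) (τ : Cell) (e : Side) :
    IntegrableOn F (G.sideIoo τ e) :=
  (hF.continuousOn.integrableOn_compact isCompact_Icc).mono_set Ioo_subset_Icc_self

theorem jump_sidePoint (hg : G.IsPiecewise P p g) {τ τ' : Cell} (hτ : τ ∈ P) (hτ' : τ' ∈ P)
    {e : Side} (hz : G.sideCoord τ' e.opp = G.sideCoord τ e) {t : ℝ} (ht : t ∈ G.sideIoo τ e)
    (ht' : t ∈ G.sideIoo τ' e) :
    jump (normal e) g (G.sidePoint τ e t) =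
      polyFun (p τ') (G.sidePoint τ e t) - polyFun (p τ) (G.sidePoint τ e t) :=
  jump_eq_of_eventually_mem (hg τ hτ) (hg τ' hτ') (G.eventually_sub_normal_mem_cell ht)
    (G.eventually_add_normal_mem_cell ht' hz)

open Classical in
/-- The cells of `P` whose side opposite to `e` lies on the line carrying the side `e` of `τ`. -/
def facing (G : Grid) (P : Finset Cell) (τ : Cell) (e : Side) : Finset Cell :=
  P.filter fun τ' => G.sideCoord τ' e.opp = G.sideCoord τ e

theorem mem_facing {τ τ' : Cell} {e : Side} :
    τ' ∈ G.facing P τ e ↔ τ' ∈ P ∧ G.sideCoord τ' e.opp = G.sideCoord τ e := by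
  simp [facing]

theorem IsPartition.pairwiseDisjoint_sideIoo (hP : G.IsPartition Q P) {S : Finset Cell}
    (hS : S ⊆ P) {e : Side} {z : ℝ} (hz : ∀ τ ∈ S, G.sideCoord τ e = z) :
    (S : Set Cell).PairwiseDisjoint fun τ => G.sideIoo τ e := by
  intro τ hτ τ' hτ' hne
  refine Set.disjoint_left.2 fun t ht ht' => hne ?_
  exact hP.eq_of_mem_sideIoo (hS hτ) (hS hτ') ((hz τ hτ).trans (hz τ' hτ').symm) ht ht'

theorem IsPartition.pairwiseDisjoint_facing (hP : G.IsPartition Q P) (τ : Cell) (e : Side) :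
    (G.facing P τ e : Set Cell).PairwiseDisjoint fun τ' => G.sideIoo τ' e :=
  hP.pairwiseDisjoint_sideIoo (e := e.opp) (fun _ h => (mem_facing.1 h).1)
    fun _ h => (mem_facing.1 h).2

/-- Almost every point of the side has exactly one facing neighbour, so a single summand survives.
The right-hand side is a finite sum of truncated continuous functions, which makes the jump
integrable. -/
theorem jump_sq_ae_eq (hP : G.IsPartition Q P) (hg : G.IsPiecewise P p g) {τ : Cell} (hτ : τ ∈ P)
    {e : Side} (he : G.side τ e ⊆ G.domain Q) :
    (fun t => jump (normal e) g (G.sidePoint τ e t) ^ 2) =ᵐ[volume.restrict (G.sideIoo τ e)]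
      fun t => ∑ τ' ∈ G.facing P τ e, (G.sideIoo τ' e).indicator (fun t =>
        (polyFun (p τ') (G.sidePoint τ e t) - polyFun (p τ) (G.sidePoint τ e t)) ^ 2) t := by
  filter_upwards [hP.exists_neighbour hτ he, ae_restrict_mem measurableSet_Ioo]
    with t ⟨τ', hτ', ht', hz⟩ ht
  rw [Finset.sum_eq_single_of_mem τ' (mem_facing.2 ⟨hτ', hz⟩), indicator_of_mem ht',
    jump_sidePoint hg hτ hτ' hz ht ht']
  intro σ hσ hne
  refine indicator_of_notMem (fun h => hne ?_) _
  exact (hP.pairwiseDisjoint_facing τ e).elim_set hσ (mem_facing.2 ⟨hτ', hz⟩) t h ht'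

theorem continuous_polyFun_sidePoint (q : MvPolynomial (Fin 2) ℝ) (τ : Cell) (e : Side) :
    Continuous fun t => polyFun q (G.sidePoint τ e t) :=
  (continuous_polyFun q).comp (continuous_sidePoint τ e)

theorem integrableOn_jump_sq (hP : G.IsPartition Q P) (hg : G.IsPiecewise P p g) {τ : Cell}
    (hτ : τ ∈ P) {e : Side} (he : G.side τ e ⊆ G.domain Q) :
    IntegrableOn (fun t => jump (normal e) g (G.sidePoint τ e t) ^ 2) (G.sideIoo τ e) := by
  refine Integrable.congr ?_ (jump_sq_ae_eq hP hg hτ he).symm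
  refine integrable_finsetSum _ fun τ' _ => Integrable.indicator ?_ (measurableSet_sideIoo _ _)
  exact integrableOn_sideIoo (((continuous_polyFun_sidePoint _ τ e).sub
    (continuous_polyFun_sidePoint _ τ e)).pow 2) τ e

/-- The jump across an interior side is controlled by the traces from both sides. -/
theorem sideL2Sq_jump_le (hP : G.IsPartition Q P) (hg : G.IsPiecewise P p g) {τ : Cell}
    (hτ : τ ∈ P) {e : Side} (he : G.side τ e ⊆ G.domain Q) :
    G.sideL2Sq τ e (jump (normal e) g) ≤ 2 * G.sideL2Sq τ e (polyFun (p τ)) +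
      2 * ∑ τ' ∈ G.facing P τ e, ∫ t in G.sideIoo τ e ∩ G.sideIoo τ' e,
        polyFun (p τ') (G.sidePoint τ' e.opp t) ^ 2 := by
  have hi : ∀ q, IntegrableOn (fun t => polyFun q (G.sidePoint τ e t) ^ 2) (G.sideIoo τ e) :=
    fun q => integrableOn_sideIoo ((continuous_polyFun_sidePoint q τ e).pow 2) τ e
  have hi' : ∀ τ' q, IntegrableOn (fun t => polyFun q (G.sidePoint τ e t) ^ 2)
      (G.sideIoo τ e ∩ G.sideIoo τ' e) := fun τ' q => (hi q).mono_set inter_subset_left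
  have hsub : ∀ τ', IntegrableOn (fun t => (polyFun (p τ') (G.sidePoint τ e t) -
      polyFun (p τ) (G.sidePoint τ e t)) ^ 2) (G.sideIoo τ e) := fun τ' =>
    integrableOn_sideIoo (((continuous_polyFun_sidePoint _ τ e).sub
      (continuous_polyFun_sidePoint _ τ e)).pow 2) τ e
  rw [sideL2Sq_eq_setIntegral, integral_congr_ae (jump_sq_ae_eq hP hg hτ he),
    integral_finsetSum _ fun τ' _ => (hsub τ').indicator (measurableSet_sideIoo _ _)]
  have hown : ∑ τ' ∈ G.facing P τ e, ∫ t in G.sideIoo τ e ∩ G.sideIoo τ' e,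
      polyFun (p τ) (G.sidePoint τ e t) ^ 2 ≤ G.sideL2Sq τ e (polyFun (p τ)) := by
    rw [sideL2Sq_eq_setIntegral]
    refine sum_setIntegral_le _ (fun _ _ => measurableSet_Ioo.inter measurableSet_Ioo) ?_
      (fun _ _ => inter_subset_left) (fun _ => sq_nonneg _) (hi _)
    exact (hP.pairwiseDisjoint_facing τ e).mono_on fun _ _ => inter_subset_right
  calc _ ≤ ∑ τ' ∈ G.facing P τ e,
        (2 * (∫ t in G.sideIoo τ e ∩ G.sideIoo τ' e, polyFun (p τ) (G.sidePoint τ e t) ^ 2) +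
          2 * ∫ t in G.sideIoo τ e ∩ G.sideIoo τ' e,
            polyFun (p τ') (G.sidePoint τ' e.opp t) ^ 2) := by
        refine Finset.sum_le_sum fun τ' hτ' => ?_
        have hpt : ∀ t, G.sidePoint τ' e.opp t = G.sidePoint τ e t := fun t => by
          rw [sidePoint_eq_pt, sidePoint_eq_pt, (mem_facing.1 hτ').2]
          rfl
        simp only [hpt]
        rw [setIntegral_indicator (measurableSet_sideIoo _ _), ← integral_const_mul,
          ← integral_const_mul, ← integral_add ((hi' _ _).const_mul _) ((hi' _ _).const_mul _)]
        refine integral_mono ((hsub τ').mono_set inter_subset_left)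
          (((hi' _ _).const_mul _).add ((hi' _ _).const_mul _)) fun t => ?_
        simp only
        nlinarith [sq_nonneg (polyFun (p τ') (G.sidePoint τ e t) +
          polyFun (p τ) (G.sidePoint τ e t))]
    _ ≤ _ := by
        rw [Finset.sum_add_distrib, ← Finset.mul_sum, ← Finset.mul_sum]
        gcongr

open Classical in
/-- The jump contribution of the side `e` of `τ`, weighted by a power of its length; it vanishes
unless the side is interior. -/
def jumpTerm (G : Grid) (Q : Finset (Fin 2 → ℤ)) (g : Plane → ℝ) (k : ℕ) (τ : Cell)
    (e : Side) : ℝ :=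
  if G.side τ e ⊆ G.domain Q then G.len τ ^ k * G.sideL2Sq τ e (jump (normal e) g) else 0

theorem jumpTerm_nonneg (k : ℕ) (τ : Cell) (e : Side) : 0 ≤ G.jumpTerm Q g k τ e := by
  unfold jumpTerm
  have := G.len_pos τ
  have := G.sideL2Sq_nonneg τ e (jump (normal e) g)
  split_ifs <;> positivity

/-- Each jump splits into the cell's own trace and its neighbours' traces. A neighbour's trace is
charged to the neighbour: mesh grading changes the weight at the cost of `max 1 c ^ k`, and after
exchanging the sums the pieces falling on one side are disjoint. No count of neighbours is needed.
-/
theorem sum_jumpTerm_le {B : Finset (Plane → ℝ)} {c : ℝ} (hP : G.IsPartition Q P)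
    (hS : G.ShapeRegular P B c) (hg : G.IsPiecewise P p g) (k : ℕ) (e : Side) :
    ∑ τ ∈ P, G.jumpTerm Q g k τ e ≤
      2 * ∑ τ ∈ P, G.len τ ^ k * G.sideL2Sq τ e (polyFun (p τ)) +
        2 * max 1 c ^ k * ∑ τ ∈ P, G.len τ ^ k * G.sideL2Sq τ e.opp (polyFun (p τ)) := by
  classical
  let F : Cell → ℝ → ℝ := fun τ' t => polyFun (p τ') (G.sidePoint τ' e.opp t) ^ 2
  have hF : ∀ τ' t, 0 ≤ F τ' t := fun _ _ => sq_nonneg _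
  have hFi : ∀ τ τ', 0 ≤ ∫ t in G.sideIoo τ e ∩ G.sideIoo τ' e, F τ' t :=
    fun _ τ' => integral_nonneg fun t => hF τ' t
  have hc : (0 : ℝ) ≤ max 1 c := zero_le_one.trans (le_max_left _ _)
  have hterm : ∀ τ ∈ P, G.jumpTerm Q g k τ e ≤
      2 * (G.len τ ^ k * G.sideL2Sq τ e (polyFun (p τ))) +
        2 * max 1 c ^ k * ∑ τ' ∈ P, if G.sideCoord τ' e.opp = G.sideCoord τ e then
          G.len τ' ^ k * ∫ t in G.sideIoo τ e ∩ G.sideIoo τ' e, F τ' t else 0 := by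
    intro τ hτ
    have hl := G.len_pos τ
    have h0 : 0 ≤ ∑ τ' ∈ P, if G.sideCoord τ' e.opp = G.sideCoord τ e then
          G.len τ' ^ k * ∫ t in G.sideIoo τ e ∩ G.sideIoo τ' e, F τ' t else 0 := by
      refine Finset.sum_nonneg fun τ' _ => ?_
      have hl' := G.len_pos τ'
      have := hFi τ τ'
      split_ifs <;> positivity
    have h1 := G.sideL2Sq_nonneg τ e (polyFun (p τ))
    unfold jumpTerm
    split_ifs with he
    · calc _ ≤ G.len τ ^ k * (2 * G.sideL2Sq τ e (polyFun (p τ)) +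
            2 * ∑ τ' ∈ G.facing P τ e, ∫ t in G.sideIoo τ e ∩ G.sideIoo τ' e, F τ' t) := by
            gcongr
            exact sideL2Sq_jump_le hP hg hτ he
        _ = 2 * (G.len τ ^ k * G.sideL2Sq τ e (polyFun (p τ))) +
            2 * ∑ τ' ∈ G.facing P τ e,
              G.len τ ^ k * ∫ t in G.sideIoo τ e ∩ G.sideIoo τ' e, F τ' t := by
            rw [← Finset.mul_sum]
            ring
        _ ≤ _ := by
            rw [mul_assoc 2 (max 1 c ^ k), ← Finset.sum_filter, Finset.mul_sum]
            have hfac : G.facing P τ e =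
              P.filter fun τ' => G.sideCoord τ' e.opp = G.sideCoord τ e := by
                ext; simp [mem_facing]
            rw [hfac, Finset.mul_sum]
            gcongr 2 * _ + ?_
            rw [Finset.mul_sum]
            refine Finset.sum_le_sum fun τ' hτ' => ?_
            rw [Finset.mem_filter] at hτ'
            by_cases hne : (G.sideIoo τ e ∩ G.sideIoo τ' e).Nonempty
            · obtain ⟨t, ht, ht'⟩ := hne
              have hlen := hS.len_le hτ hτ'.1 hτ'.2 ht ht'
              have := hFi τ τ'
              have hpow := pow_le_pow_left₀ hl.le hlen k
              rw [mul_pow] at hpow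
              calc _ ≤ 2 * ((max 1 c ^ k * G.len τ' ^ k) *
                    ∫ t in G.sideIoo τ e ∩ G.sideIoo τ' e, F τ' t) := by gcongr
                _ = _ := by ring
            · rw [not_nonempty_iff_eq_empty.1 hne]
              simp
    · positivity
  refine (Finset.sum_le_sum hterm).trans ?_
  rw [Finset.sum_add_distrib, ← Finset.mul_sum, ← Finset.mul_sum, Finset.sum_comm]
  gcongr with τ' hτ'
  rw [← Finset.sum_filter, ← Finset.mul_sum]
  have hl' := G.len_pos τ'
  gcongr
  rw [sideL2Sq_eq_setIntegral]
  refine sum_setIntegral_le _ (fun _ _ => measurableSet_Ioo.inter measurableSet_Ioo) ?_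
    (fun _ _ => inter_subset_right) (hF τ')
    (integrableOn_sideIoo ((continuous_polyFun_sidePoint _ τ' e.opp).pow 2) τ' e)
  refine (hP.pairwiseDisjoint_sideIoo (z := G.sideCoord τ' e.opp) (e := e)
    (Finset.filter_subset _ _) fun τ hτ => ?_).mono_on fun _ _ => inter_subset_left
  exact (Finset.mem_filter.1 hτ).2.symm

/-- Under refinement the jump terms of a piecewise polynomial on the coarse partition decrease. -/
theorem sum_jumpTerm_children_le (hP : G.IsPartition Q P) (hPs : G.IsPartition Q Ps)
    (hg : G.IsPiecewise P p g) {τ : Cell} (hτ : τ ∈ P) {S : Finset Cell} (hS : S ⊆ Ps)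
    {ρ : ℝ} (hρ0 : 0 ≤ ρ) (hρ1 : ρ ≤ 1)
    (hsub : ∀ τs ∈ S, G.cell τs ⊆ G.cell τ ∧ G.len τs ≤ ρ * G.len τ) {k : ℕ} (hk : k ≠ 0)
    (e : Side) : ∑ τs ∈ S, G.jumpTerm Q g k τs e ≤ ρ * G.jumpTerm Q g k τ e := by
  classical
  have hl := G.len_pos τ
  -- A descendant's side off the line of `e` runs through the interior of `τ`, where `g` is a single
  -- polynomial and has no jump.
  have hzero : ∀ τs ∈ S, G.sideCoord τs e ≠ G.sideCoord τ e → G.jumpTerm Q g k τs e = 0 := by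
    intro τs hτs hne
    have hc := G.corner_le_of_cell_subset (hsub τs hτs).1
    have hls := G.len_pos τs
    unfold jumpTerm
    split_ifs
    · rw [sideL2Sq_eq_setIntegral, setIntegral_eq_zero_of_forall_eq_zero, mul_zero]
      intro t ht
      have hx : G.sidePoint τs e t ∈ G.cell τ := by
        rw [sidePoint_eq_pt, pt_mem_cell]
        refine ⟨?_, Ioo_subset_Ioo (hc _).1 (hc _).2 ht⟩
        have := hc e.1
        unfold sideCoord at hne ⊢
        cases hb : e.2
        · simp only [hb, Bool.false_eq_true, ↓reduceIte, add_zero] at hne ⊢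
          exact ⟨lt_of_le_of_ne this.1 (Ne.symm hne), by linarith⟩
        · simp only [hb, ↓reduceIte] at hne ⊢
          exact ⟨by linarith, lt_of_le_of_ne this.2 hne⟩
      rw [jump_eq_zero (G.isOpen_cell τ) (hg τ hτ) hx]
      simp
    · rfl
  by_cases he : G.side τ e ⊆ G.domain Q
  · let A := S.filter fun τs => G.sideCoord τs e = G.sideCoord τ e
    let J : ℝ → ℝ := fun t => jump (normal e) g (G.sidePoint τ e t) ^ 2
    calc _ = ∑ τs ∈ A, G.jumpTerm Q g k τs e := by
          rw [Finset.sum_filter]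
          refine Finset.sum_congr rfl fun τs hτs => ?_
          split_ifs with h
          · rfl
          · exact hzero τs hτs h
      _ ≤ ∑ τs ∈ A, ρ * G.len τ ^ k * ∫ t in G.sideIoo τs e, J t := by
          refine Finset.sum_le_sum fun τs hτs => ?_
          obtain ⟨hτs, hz⟩ := Finset.mem_filter.1 hτs
          have hls := G.len_pos τs
          have hJ : 0 ≤ ∫ t in G.sideIoo τs e, J t := integral_nonneg fun t => sq_nonneg _
          unfold jumpTerm
          split_ifs
          · rw [sideL2Sq_eq_setIntegral]
            simp only [sidePoint_eq_pt, hz]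
            refine mul_le_mul_of_nonneg_right ?_ hJ
            calc G.len τs ^ k ≤ (ρ * G.len τ) ^ k := by
                  gcongr
                  exact (hsub τs hτs).2
              _ = ρ ^ k * G.len τ ^ k := mul_pow _ _ _
              _ ≤ ρ * G.len τ ^ k := by
                  gcongr
                  exact pow_le_of_le_one hρ0 hρ1 hk
          · positivity
      _ = ρ * G.len τ ^ k * ∑ τs ∈ A, ∫ t in G.sideIoo τs e, J t := by rw [Finset.mul_sum]
      _ ≤ ρ * G.len τ ^ k * ∫ t in G.sideIoo τ e, J t := by
          gcongr
          refine sum_setIntegral_le _ (fun _ _ => measurableSet_Ioo) ?_ ?_ (fun _ => sq_nonneg _)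
            (integrableOn_jump_sq hP hg hτ he)
          · exact hPs.pairwiseDisjoint_sideIoo ((Finset.filter_subset _ _).trans hS)
              fun τs hτs => (Finset.mem_filter.1 hτs).2
          · intro τs hτs
            have hc := G.corner_le_of_cell_subset
              (hsub τs (Finset.mem_filter.1 hτs).1).1 (1 - e.1)
            exact Ioo_subset_Ioo hc.1 hc.2
      _ = _ := by
          rw [jumpTerm, if_pos he, sideL2Sq_eq_setIntegral, mul_assoc]
  -- A piece of a non-interior side is not interior either, so refinement creates no jump terms
  -- there.
  · rw [jumpTerm, if_neg he, mul_zero]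
    refine (Finset.sum_eq_zero fun τs hτs => ?_).le
    by_cases hz : G.sideCoord τs e = G.sideCoord τ e
    · exact if_neg fun h => he (side_subset_domain (hsub τs hτs).1 hz h)
    · exact hzero τs hτs hz

/-- The relation between `g`, `g₁` and `g₂` is required only inside cells: jumps are one-sided
limits and ignore the values of classical derivatives on edges, where these need not be additive. -/
theorem jumpTerm_le_young {p₁ p₂ : Cell → MvPolynomial (Fin 2) ℝ} {g₁ g₂ : Plane → ℝ}
    (hP : G.IsPartition Q P) (h₁ : G.IsPiecewise P p₁ g₁) (h₂ : G.IsPiecewise P p₂ g₂)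
    (hg : G.IsPiecewise P (fun τ => p₁ τ - p₂ τ) g) {τ : Cell} (hτ : τ ∈ P) (k : ℕ) (e : Side)
    {δ : ℝ} (hδ : 0 < δ) :
    G.jumpTerm Q g k τ e ≤
      (1 + δ) * G.jumpTerm Q g₁ k τ e + (1 + 1 / δ) * G.jumpTerm Q g₂ k τ e := by
  unfold jumpTerm
  split_ifs with he
  · have hl := G.len_pos τ
    calc _ ≤ G.len τ ^ k * ((1 + δ) * G.sideL2Sq τ e (jump (normal e) g₁) +
          (1 + 1 / δ) * G.sideL2Sq τ e (jump (normal e) g₂)) := by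
          gcongr
          simp only [sideL2Sq_eq_setIntegral]
          refine integral_sq_le_young ?_ (integrableOn_jump_sq hP h₁ hτ he)
            (integrableOn_jump_sq hP h₂ hτ he) hδ
          filter_upwards [hP.exists_neighbour hτ he, ae_restrict_mem measurableSet_Ioo]
            with t ⟨τ', hτ', ht', hz⟩ ht
          rw [jump_sidePoint hg hτ hτ' hz ht ht', jump_sidePoint h₁ hτ hτ' hz ht ht',
            jump_sidePoint h₂ hτ hτ' hz ht ht', polyFun_sub, polyFun_sub]
          ring
      _ = _ := by ring
  · simp

end Grid

/-! ### Indicators, estimators and the energy -/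

namespace Grid

variable {G : Grid} {Q : Finset (Fin 2 → ℤ)} {P Ps : Finset Cell} {f V : Plane → ℝ}
  {p : Cell → MvPolynomial (Fin 2) ℝ}

theorem indicatorSq_eq (f V : Plane → ℝ) (τ : Cell) :
    G.indicatorSq Q f V τ =
      (√2 * G.len τ) ^ 4 * (∫ x in G.cell τ, (f x - lap (lap V) x) ^ 2) +
        ∑ e : Side, (G.jumpTerm Q (fun y => fderiv ℝ (lap V) y (normal e)) 3 τ e +
          G.jumpTerm Q (lap V) 1 τ e) := by
  unfold indicatorSq jumpTerm
  simp only [diam_cell, diam_side, pow_one]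
  congr 1
  refine Finset.sum_congr rfl fun e _ => ?_
  split_ifs <;> simp

theorem indicatorSq_nonneg (f V : Plane → ℝ) (τ : Cell) : 0 ≤ G.indicatorSq Q f V τ := by
  rw [indicatorSq_eq]
  refine add_nonneg (mul_nonneg (by positivity) (integral_nonneg fun x => sq_nonneg _)) ?_
  exact Finset.sum_nonneg fun e _ => add_nonneg (jumpTerm_nonneg _ _ _) (jumpTerm_nonneg _ _ _)

theorem integrableOn_residual_sq (hP : G.IsPartition Q P)
    (hf : MemLp f 2 (volume.restrict (G.domain Q))) (hV : G.IsPiecewise P p V) {τ : Cell}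
    (hτ : τ ∈ P) : IntegrableOn (fun x => (f x - lap (lap V) x) ^ 2) (G.cell τ) := by
  have hf' : MemLp f 2 (volume.restrict (G.cell τ)) :=
    hf.mono_measure (Measure.restrict_mono (hP.cell_subset_domain hτ) le_rfl)
  have hc := continuous_polyFun (lapPoly (lapPoly (p τ)))
  have hp : MemLp (polyFun (lapPoly (lapPoly (p τ)))) 2 (volume.restrict (G.cell τ)) :=
    (memLp_two_iff_integrable_sq hc.aestronglyMeasurable).2
      (G.integrableOn_cell_of_continuous (hc.pow 2) τ)
  refine Integrable.congr (hf'.sub hp).integrable_sq ?_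
  filter_upwards [ae_restrict_mem (G.measurableSet_cell τ)] with x hx
  rw [Pi.sub_apply, hV.lap.lap τ hτ hx]

/-- The indicators of the descendants of a cell add up to at most its own indicator, reduced by
the factor by which the mesh size decreases. -/
theorem sum_indicatorSq_children_le (hP : G.IsPartition Q P) (hPs : G.IsPartition Q Ps)
    (hf : MemLp f 2 (volume.restrict (G.domain Q))) (hV : G.IsPiecewise P p V)
    {τ : Cell} (hτ : τ ∈ P) {S : Finset Cell} (hS : S ⊆ Ps) {ρ : ℝ} (hρ0 : 0 ≤ ρ) (hρ1 : ρ ≤ 1)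
    (hsub : ∀ τs ∈ S, G.cell τs ⊆ G.cell τ ∧ G.len τs ≤ ρ * G.len τ) :
    ∑ τs ∈ S, G.indicatorSq Q f V τs ≤ ρ * G.indicatorSq Q f V τ := by
  have hl := G.len_pos τ
  simp only [indicatorSq_eq]
  rw [Finset.sum_add_distrib, mul_add, Finset.sum_comm, Finset.mul_sum]
  gcongr with e
  · calc _ ≤ ∑ τs ∈ S, ρ * (√2 * G.len τ) ^ 4 *
          ∫ x in G.cell τs, (f x - lap (lap V) x) ^ 2 := by
          refine Finset.sum_le_sum fun τs hτs => ?_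
          refine mul_le_mul_of_nonneg_right ?_ (integral_nonneg fun x => sq_nonneg _)
          have hls := G.len_pos τs
          calc (√2 * G.len τs) ^ 4 ≤ (√2 * (ρ * G.len τ)) ^ 4 := by
                gcongr
                exact (hsub τs hτs).2
            _ = ρ ^ 4 * (√2 * G.len τ) ^ 4 := by ring
            _ ≤ _ := by
                gcongr
                exact pow_le_of_le_one hρ0 hρ1 (by norm_num)
      _ ≤ ρ * (√2 * G.len τ) ^ 4 * ∫ x in G.cell τ, (f x - lap (lap V) x) ^ 2 := by
          rw [← Finset.mul_sum]
          gcongr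
          exact sum_setIntegral_le _ (fun τs _ => G.measurableSet_cell τs)
            (hPs.1.subset (by exact_mod_cast hS)) (fun τs hτs => (hsub τs hτs).1)
            (fun _ => sq_nonneg _) (integrableOn_residual_sq hP hf hV hτ)
      _ = _ := by ring
  · rw [Finset.sum_add_distrib, mul_add]
    exact add_le_add
      (sum_jumpTerm_children_le hP hPs (hV.lap.fderiv_normal e) hτ hS hρ0 hρ1 hsub
        (by norm_num) e)
      (sum_jumpTerm_children_le hP hPs hV.lap hτ hS hρ0 hρ1 hsub (by norm_num) e)

/-- Estimator reduction for a fixed coarse function. -/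
theorem estimatorSq_refinement_le {M : Finset Cell} (hP : G.IsPartition Q P)
    (hPs : G.IsPartition Q Ps) (hf : MemLp f 2 (volume.restrict (G.domain Q)))
    (hV : G.IsPiecewise P p V) (hM : M ⊆ P) (hR : G.IsRefinement P M Ps) :
    G.estimatorSq Q f V Ps ≤ G.estimatorSq Q f V P - 1 / 2 * G.estimatorSq Q f V M := by
  classical
  obtain ⟨hpar, hmark⟩ := hR
  have hcell : ∀ τ ∈ P, ∑ τs ∈ Ps.filter (fun τs => G.cell τs ⊆ G.cell τ),
      G.indicatorSq Q f V τs ≤ (if τ ∈ M then 1 / 2 else 1) * G.indicatorSq Q f V τ := by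
    intro τ hτ
    -- The ratio is `ρ = 1 / 2` for a marked cell, whose descendants are proper subcells, and `ρ =
    -- 1` otherwise.
    refine sum_indicatorSq_children_le hP hPs hf hV hτ (Finset.filter_subset _ _)
      (by split_ifs <;> norm_num) (by split_ifs <;> norm_num) fun τs hτs => ?_
    obtain ⟨h1, h2⟩ := Finset.mem_filter.1 hτs
    refine ⟨h2, ?_⟩
    split_ifs with hm
    · exact G.len_le_half_of_cell_subset h2 fun h => hmark τ hm (h ▸ h1)
    · rw [one_mul]
      exact G.len_le_of_cell_subset h2
  calc G.estimatorSq Q f V Ps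
      ≤ ∑ τs ∈ P.biUnion fun τ => Ps.filter (fun τs => G.cell τs ⊆ G.cell τ),
        G.indicatorSq Q f V τs := by
        refine Finset.sum_le_sum_of_subset_of_nonneg (fun τs hτs => ?_)
          fun _ _ _ => indicatorSq_nonneg _ _ _
        obtain ⟨τ, hτ, hsub⟩ := hpar τs hτs
        exact Finset.mem_biUnion.2 ⟨τ, hτ, Finset.mem_filter.2 ⟨hτs, hsub⟩⟩
    _ = ∑ τ ∈ P, ∑ τs ∈ Ps.filter (fun τs => G.cell τs ⊆ G.cell τ),
        G.indicatorSq Q f V τs := by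
        refine Finset.sum_biUnion fun τ hτ τ' hτ' hne => ?_
        refine Finset.disjoint_left.2 fun τs h h' => hne ?_
        obtain ⟨x, hx⟩ := G.nonempty_cell τs
        exact hP.eq_of_mem_cell hτ hτ' ((Finset.mem_filter.1 h).2 hx)
          ((Finset.mem_filter.1 h').2 hx)
    _ ≤ ∑ τ ∈ P, (if τ ∈ M then 1 / 2 else 1) * G.indicatorSq Q f V τ := Finset.sum_le_sum hcell
    _ = ∑ τ ∈ P, (G.indicatorSq Q f V τ -
        1 / 2 * if τ ∈ M then G.indicatorSq Q f V τ else 0) := by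
        refine Finset.sum_congr rfl fun τ _ => ?_
        split_ifs <;> ring
    _ = _ := by
        rw [Finset.sum_sub_distrib, ← Finset.mul_sum, ← Finset.sum_filter,
          Finset.filter_mem_eq_inter, Finset.inter_eq_right.2 hM]
        rfl

/-- Comparison of the estimators of two piecewise polynomials on the same partition. -/
theorem estimatorSq_le_young {ps : Cell → MvPolynomial (Fin 2) ℝ} {Vs : Plane → ℝ}
    (hP : G.IsPartition Q P) (hf : MemLp f 2 (volume.restrict (G.domain Q)))
    (hV : G.IsPiecewise P p V) (hVs : G.IsPiecewise P ps Vs) {δ : ℝ} (hδ : 0 < δ) :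
    G.estimatorSq Q f Vs P ≤ (1 + δ) * G.estimatorSq Q f V P +
      (1 + 1 / δ) * G.estimatorSq Q 0 (V - Vs) P := by
  unfold estimatorSq
  rw [Finset.mul_sum, Finset.mul_sum, ← Finset.sum_add_distrib]
  refine Finset.sum_le_sum fun τ hτ => ?_
  have hl := G.len_pos τ
  have hD := hV.sub hVs
  -- Writing `Vs` as `V - (V - Vs)` on the level of polynomials puts its Laplacian and normal
  -- derivatives in the form that `jumpTerm_le_young` expects.
  have hVs' : G.IsPiecewise P (fun τ => p τ - (p τ - ps τ)) Vs := by simpa using hVs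
  have hlap : G.IsPiecewise P (fun τ => lapPoly (p τ) - lapPoly (p τ - ps τ)) (SplineAFEM.lap Vs) :=
    fun τ hτ => by
      simp only [← lapPoly_sub]
      exact hVs'.lap τ hτ
  have hn : ∀ e : Side, G.IsPiecewise P
      (fun τ => (if e.2 then (1 : ℝ) else -1) • MvPolynomial.pderiv e.1 (lapPoly (p τ)) -
        (if e.2 then (1 : ℝ) else -1) • MvPolynomial.pderiv e.1 (lapPoly (p τ - ps τ)))
      (fun y => fderiv ℝ (SplineAFEM.lap Vs) y (normal e)) := fun e τ hτ => by
    simp only [← smul_sub, ← map_sub]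
    exact hlap.fderiv_normal e τ hτ
  simp only [indicatorSq_eq]
  have hbulk : ∫ x in G.cell τ, (f x - lap (lap Vs) x) ^ 2 ≤
      (1 + δ) * (∫ x in G.cell τ, (f x - lap (lap V) x) ^ 2) +
        (1 + 1 / δ) * ∫ x in G.cell τ, ((0 : Plane → ℝ) x - lap (lap (V - Vs)) x) ^ 2 := by
    refine integral_sq_le_young ?_ (integrableOn_residual_sq hP hf hV hτ)
      (integrableOn_residual_sq hP MemLp.zero hD hτ) hδ
    filter_upwards [ae_restrict_mem (G.measurableSet_cell τ)] with x hx
    rw [hV.lap.lap τ hτ hx, hVs.lap.lap τ hτ hx, hD.lap.lap τ hτ hx]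
    simp only [lapPoly_sub, polyFun_sub, Pi.zero_apply]
    ring
  have hsides : ∑ e : Side, (G.jumpTerm Q (fun y => fderiv ℝ (lap Vs) y (normal e)) 3 τ e +
      G.jumpTerm Q (lap Vs) 1 τ e) ≤
      (1 + δ) * (∑ e : Side, (G.jumpTerm Q (fun y => fderiv ℝ (lap V) y (normal e)) 3 τ e +
        G.jumpTerm Q (lap V) 1 τ e)) +
      (1 + 1 / δ) * ∑ e : Side,
        (G.jumpTerm Q (fun y => fderiv ℝ (lap (V - Vs)) y (normal e)) 3 τ e +
          G.jumpTerm Q (lap (V - Vs)) 1 τ e) := by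
    rw [Finset.mul_sum, Finset.mul_sum, ← Finset.sum_add_distrib]
    refine Finset.sum_le_sum fun e _ => ?_
    have h1 := jumpTerm_le_young hP (hV.lap.fderiv_normal e) (hD.lap.fderiv_normal e) (hn e)
      hτ 3 e hδ
    have h2 := jumpTerm_le_young hP hV.lap hD.lap hlap hτ 1 e hδ
    linarith
  have hb := mul_le_mul_of_nonneg_left hbulk (by positivity : 0 ≤ (√2 * G.len τ) ^ 4)
  linarith

/-- Edges are null. This transfers integrability from the open cells to the closed cells, which
cover the domain. -/
theorem cell_ae_eq_closedCell (τ : Cell) : G.cell τ =ᵐ[volume] G.closedCell τ := by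
  have h1 : (fun z : ℝ × ℝ => pt 0 z.1 z.2) ⁻¹' G.cell τ =
      Ioo (G.corner τ 0) (G.corner τ 0 + G.len τ) ×ˢ
        Ioo (G.corner τ (1 - 0)) (G.corner τ (1 - 0) + G.len τ) := by
    ext z
    simp only [mem_preimage, pt_mem_cell, mem_prod]
  have h2 : (fun z : ℝ × ℝ => pt 0 z.1 z.2) ⁻¹' G.closedCell τ =
      Icc (G.corner τ 0) (G.corner τ 0 + G.len τ) ×ˢ
        Icc (G.corner τ (1 - 0)) (G.corner τ (1 - 0) + G.len τ) := by
    ext z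
    simp only [mem_preimage, pt_mem_closedCell, mem_prod]
  have hm : volume (G.closedCell τ) = volume (G.cell τ) := by
    rw [← (measurePreserving_pt 0).measure_preimage_emb (measurableEmbedding_pt 0),
      ← (measurePreserving_pt 0).measure_preimage_emb (measurableEmbedding_pt 0), h1, h2,
      Measure.volume_eq_prod, Measure.prod_prod, Measure.prod_prod]
    simp
  exact ae_eq_of_subset_of_measure_ge (G.cell_subset_closedCell τ) hm.le
    (G.measurableSet_cell τ).nullMeasurableSet (G.isCompact_closedCell τ).measure_ne_top

theorem sum_setIntegral_lap_le_energySq (hP : G.IsPartition Q P) {D : Plane → ℝ}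
    (hD : G.IsPiecewise P p D) :
    ∑ τ ∈ P, ∫ x in G.cell τ, polyFun (lapPoly (p τ)) x ^ 2 ≤ G.energySq Q D := by
  have hcell : ∀ τ ∈ P, EqOn (fun x => lap D x ^ 2) (fun x => polyFun (lapPoly (p τ)) x ^ 2)
      (G.cell τ) := fun τ hτ x hx => by
    simp only [hD.lap τ hτ hx]
  have hint : IntegrableOn (fun x => lap D x ^ 2) (G.domain Q) := by
    have hsub : G.domain Q ⊆ ⋃ τ ∈ P, G.closedCell τ := hP.2 ▸ subset_closure
    refine IntegrableOn.mono_set ?_ hsub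
    refine integrableOn_finset_iUnion.2 fun τ hτ => ?_
    refine IntegrableOn.congr_set_ae ?_ (cell_ae_eq_closedCell τ).symm
    exact (integrableOn_congr_fun (hcell τ hτ) (G.measurableSet_cell τ)).2
      (G.integrableOn_cell_of_continuous ((continuous_polyFun _).pow 2) τ)
  calc _ = ∑ τ ∈ P, ∫ x in G.cell τ, lap D x ^ 2 :=
        Finset.sum_congr rfl fun τ hτ =>
          setIntegral_congr_fun (G.measurableSet_cell τ) (hcell τ hτ).symm
    _ ≤ _ := sum_setIntegral_le _ (fun τ _ => G.measurableSet_cell τ) hP.1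
        (fun τ hτ => hP.cell_subset_domain hτ) (fun _ => sq_nonneg _) hint

/-- Without load, the estimator of a piecewise polynomial is bounded by its energy. -/
theorem exists_estimatorSq_zero_le (r : ℕ) (c : ℝ) : ∃ C : ℝ, 0 < C ∧
    ∀ (G : Grid) (Q : Finset (Fin 2 → ℤ)) (P : Finset Cell) (B : Finset (Plane → ℝ))
      (p : Cell → MvPolynomial (Fin 2) ℝ) (D : Plane → ℝ), G.IsPartition Q P →
      G.ShapeRegular P B c → G.IsPiecewise P p D →
      (∀ τ ∈ P, p τ ∈ MvPolynomial.restrictDegree (Fin 2) ℝ r) →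
      G.estimatorSq Q 0 D P ≤ C * G.energySq Q D := by
  obtain ⟨K, hK, H⟩ := exists_inverse_estimate_cell r
  have hc : (0 : ℝ) < max 1 c := zero_lt_one.trans_le (le_max_left _ _)
  -- Bulk term: `√2 ^ 4 = 4`, a factor `2` from squaring a sum, and two pure second derivatives
  -- costing `K ^ 2` each. The other summand counts four sides, each with its normal derivative and
  -- value jumps.
  refine ⟨16 * K ^ 2 + 4 * (2 * K ^ 2 * (1 + max 1 c ^ 3) + 2 * K * (1 + max 1 c)),
    by positivity, fun G Q P B p D hP hS hD hdeg => ?_⟩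
  let L : Cell → MvPolynomial (Fin 2) ℝ := fun τ => lapPoly (p τ)
  have hL : ∀ τ ∈ P, L τ ∈ MvPolynomial.restrictDegree (Fin 2) ℝ r := fun τ hτ =>
    lapPoly_mem_restrictDegree (hdeg τ hτ)
  let E : Cell → ℝ := fun τ => ∫ x in G.cell τ, polyFun (L τ) x ^ 2
  refine le_trans ?_ (mul_le_mul_of_nonneg_left (sum_setIntegral_lap_le_energySq hP hD) (by positivity))
  change _ ≤ _ * ∑ τ ∈ P, E τ
  have hbulk : ∀ τ ∈ P, (√2 * G.len τ) ^ 4 *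
      (∫ x in G.cell τ, ((0 : Plane → ℝ) x - lap (lap D) x) ^ 2) ≤ 16 * K ^ 2 * E τ := by
    intro τ hτ
    have hl := G.len_pos τ
    have h2 : ∀ i, G.len τ ^ 4 * (∫ x in G.cell τ,
        polyFun (MvPolynomial.pderiv i (MvPolynomial.pderiv i (L τ))) x ^ 2) ≤ K ^ 2 * E τ := by
      intro i
      have ha := (H _ (hL τ hτ) G τ).1 i
      have hb := (H _ (pderiv_mem_restrictDegree (hL τ hτ) i) G τ).1 i
      calc _ = G.len τ ^ 2 * (G.len τ ^ 2 * ∫ x in G.cell τ,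
            polyFun (MvPolynomial.pderiv i (MvPolynomial.pderiv i (L τ))) x ^ 2) := by ring
        _ ≤ G.len τ ^ 2 * (K * ∫ x in G.cell τ,
            polyFun (MvPolynomial.pderiv i (L τ)) x ^ 2) := by gcongr
        _ = K * (G.len τ ^ 2 * ∫ x in G.cell τ,
            polyFun (MvPolynomial.pderiv i (L τ)) x ^ 2) := by ring
        _ ≤ K * (K * E τ) := by gcongr
        _ = _ := by ring
    have hi : ∀ q, IntegrableOn (fun x => polyFun q x ^ 2) (G.cell τ) := fun q =>
      G.integrableOn_cell_of_continuous ((continuous_polyFun q).pow 2) τ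
    have h4 : √2 ^ 4 = 4 := by
      rw [show 4 = 2 * 2 from rfl, pow_mul, Real.sq_sqrt zero_le_two]
      norm_num
    have hle : ∫ x in G.cell τ, ((0 : Plane → ℝ) x - lap (lap D) x) ^ 2 ≤
        2 * (∫ x in G.cell τ,
          polyFun (MvPolynomial.pderiv 0 (MvPolynomial.pderiv 0 (L τ))) x ^ 2) +
        2 * ∫ x in G.cell τ,
          polyFun (MvPolynomial.pderiv 1 (MvPolynomial.pderiv 1 (L τ))) x ^ 2 := by
      rw [← integral_const_mul, ← integral_const_mul,
        ← integral_add ((hi _).const_mul _) ((hi _).const_mul _)]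
      refine setIntegral_mono_on (integrableOn_residual_sq hP MemLp.zero hD hτ)
        (((hi _).const_mul _).add ((hi _).const_mul _)) (G.measurableSet_cell τ) fun x hx => ?_
      have hsum : polyFun (lapPoly (L τ)) x =
          polyFun (MvPolynomial.pderiv 0 (MvPolynomial.pderiv 0 (L τ))) x +
            polyFun (MvPolynomial.pderiv 1 (MvPolynomial.pderiv 1 (L τ))) x := by
        rw [lapPoly, Fin.sum_univ_two, polyFun_add]
      rw [hD.lap.lap τ hτ hx, Pi.zero_apply]
      change (0 - polyFun (lapPoly (L τ)) x) ^ 2 ≤ _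
      rw [hsum]
      nlinarith [sq_nonneg (polyFun (MvPolynomial.pderiv 0 (MvPolynomial.pderiv 0
        (L τ))) x - polyFun (MvPolynomial.pderiv 1 (MvPolynomial.pderiv 1
        (L τ))) x)]
    rw [mul_pow, h4]
    have := mul_le_mul_of_nonneg_left hle (by positivity : 0 ≤ 4 * G.len τ ^ 4)
    linarith [h2 0, h2 1]
  have htrace : ∀ τ ∈ P, ∀ e, G.len τ ^ 1 * G.sideL2Sq τ e (polyFun (L τ)) ≤ K * E τ := by
    intro τ hτ e
    rw [pow_one]
    exact (H _ (hL τ hτ) G τ).2 e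
  have htrace' : ∀ τ ∈ P, ∀ (e e' : Side), G.len τ ^ 3 * G.sideL2Sq τ e'
      (polyFun ((if e.2 then (1 : ℝ) else -1) • MvPolynomial.pderiv e.1 (L τ))) ≤
        K ^ 2 * E τ := by
    intro τ hτ e e'
    have hl := G.len_pos τ
    have hs : G.sideL2Sq τ e'
        (polyFun ((if e.2 then (1 : ℝ) else -1) • MvPolynomial.pderiv e.1 (L τ))) =
        G.sideL2Sq τ e' (polyFun (MvPolynomial.pderiv e.1 (L τ))) := by
      simp only [sideL2Sq, polyFun_smul, mul_pow]
      split_ifs <;> simp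
    rw [hs]
    have ha := (H _ (hL τ hτ) G τ).1 e.1
    have hb := (H _ (pderiv_mem_restrictDegree (hL τ hτ) e.1) G τ).2 e'
    calc _ = G.len τ ^ 2 * (G.len τ * G.sideL2Sq τ e'
          (polyFun (MvPolynomial.pderiv e.1 (L τ)))) := by ring
      _ ≤ G.len τ ^ 2 * (K * ∫ x in G.cell τ,
          polyFun (MvPolynomial.pderiv e.1 (L τ)) x ^ 2) := by gcongr
      _ = K * (G.len τ ^ 2 * ∫ x in G.cell τ,
          polyFun (MvPolynomial.pderiv e.1 (L τ)) x ^ 2) := by ring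
      _ ≤ K * (K * E τ) := by gcongr
      _ = _ := by ring
  have hside : ∀ e : Side, ∑ τ ∈ P, G.jumpTerm Q (lap D) 1 τ e ≤
      2 * K * (1 + max 1 c) * ∑ τ ∈ P, E τ := by
    intro e
    refine (sum_jumpTerm_le hP hS hD.lap 1 e).trans ?_
    calc _ ≤ 2 * ∑ τ ∈ P, K * E τ + 2 * max 1 c ^ 1 * ∑ τ ∈ P, K * E τ := by
          gcongr 2 * ?_ + 2 * max 1 c ^ 1 * ?_
          · exact Finset.sum_le_sum fun τ hτ => htrace τ hτ e
          · exact Finset.sum_le_sum fun τ hτ => htrace τ hτ e.opp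
      _ = _ := by rw [← Finset.mul_sum]; ring
  have hside' : ∀ e : Side,
      ∑ τ ∈ P, G.jumpTerm Q (fun y => fderiv ℝ (lap D) y (normal e)) 3 τ e ≤
      2 * K ^ 2 * (1 + max 1 c ^ 3) * ∑ τ ∈ P, E τ := by
    intro e
    refine (sum_jumpTerm_le hP hS (hD.lap.fderiv_normal e) 3 e).trans ?_
    calc _ ≤ 2 * ∑ τ ∈ P, K ^ 2 * E τ + 2 * max 1 c ^ 3 * ∑ τ ∈ P, K ^ 2 * E τ := by
          gcongr 2 * ?_ + 2 * max 1 c ^ 3 * ?_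
          · exact Finset.sum_le_sum fun τ hτ => htrace' τ hτ e e
          · exact Finset.sum_le_sum fun τ hτ => htrace' τ hτ e e.opp
      _ = _ := by rw [← Finset.mul_sum]; ring
  unfold estimatorSq
  simp only [indicatorSq_eq]
  rw [Finset.sum_add_distrib, Finset.sum_comm]
  calc _ ≤ ∑ τ ∈ P, 16 * K ^ 2 * E τ + ∑ _e : Side,
        (2 * K ^ 2 * (1 + max 1 c ^ 3) * ∑ τ ∈ P, E τ +
          2 * K * (1 + max 1 c) * ∑ τ ∈ P, E τ) := by
        refine add_le_add (Finset.sum_le_sum hbulk) (Finset.sum_le_sum fun e _ => ?_)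
        rw [Finset.sum_add_distrib]
        exact add_le_add (hside' e) (hside e)
    _ = _ := by
        rw [← Finset.mul_sum, Finset.sum_const, Finset.card_univ]
        simp
        ring

/-- The elements of the span of piecewise polynomials are piecewise polynomials. -/
theorem exists_isPiecewise_of_mem_span {r : ℕ} {B : Finset (Plane → ℝ)}
    (hB : ∀ β ∈ B, G.IsSpline Q r P β) (hV : V ∈ Submodule.span ℝ (B : Set (Plane → ℝ))) :
    ∃ p : Cell → MvPolynomial (Fin 2) ℝ, G.IsPiecewise P p V ∧
      ∀ τ, p τ ∈ MvPolynomial.restrictDegree (Fin 2) ℝ r := by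
  have key : ∀ τ ∈ P, ∃ q ∈ MvPolynomial.restrictDegree (Fin 2) ℝ r,
      EqOn V (polyFun q) (G.cell τ) := by
    intro τ hτ
    induction hV using Submodule.span_induction with
    | mem β hβ =>
      obtain ⟨q, hq, h⟩ := (hB β hβ).2 τ hτ
      exact ⟨q, mem_restrictDegree_iff_degreeOf_le.2 hq, h⟩
    | zero => exact ⟨0, Submodule.zero_mem _, fun x _ => by simp [polyFun]⟩
    | add u v _ _ hu hv =>
      obtain ⟨q, hq, h⟩ := hu
      obtain ⟨q', hq', h'⟩ := hv
      exact ⟨q + q', Submodule.add_mem _ hq hq', fun x hx => by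
        rw [Pi.add_apply, h hx, h' hx, polyFun_add]⟩
    | smul a u _ hu =>
      obtain ⟨q, hq, h⟩ := hu
      exact ⟨a • q, Submodule.smul_mem _ a hq, fun x hx => by
        rw [Pi.smul_apply, h hx, polyFun_smul, smul_eq_mul]⟩
  classical
  choose! q hq hV' using key
  refine ⟨fun τ => if τ ∈ P then q τ else 0, fun τ hτ => ?_, fun τ => ?_⟩
  · simpa [hτ] using hV' τ hτ
  · simp only
    split_ifs with h
    · exact hq τ h
    · exact Submodule.zero_mem _

theorem exists_isPiecewise_refinement {r : ℕ} {M : Finset Cell} (hR : G.IsRefinement P M Ps)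
    (hV : G.IsPiecewise P p V) (hp : ∀ τ, p τ ∈ MvPolynomial.restrictDegree (Fin 2) ℝ r) :
    ∃ q : Cell → MvPolynomial (Fin 2) ℝ, G.IsPiecewise Ps q V ∧
      ∀ τ, q τ ∈ MvPolynomial.restrictDegree (Fin 2) ℝ r := by
  have h := hR.1
  choose! parent hpar hsub using h
  exact ⟨fun τs => p (parent τs), fun τs hτs => (hV _ (hpar τs hτs)).mono (hsub τs hτs),
    fun τs => hp _⟩

end Grid

end SplineAFEM

end

/-! ### The theorem -/

/-- Estimator error reduction. The constant depends only on the polynomial degree and the shape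
regularity constant. `B` and `Bs` are the spline bases on `P` and `Ps`, and the spline spaces are
their spans. -/
theorem mainTheorem7 (r : ℕ) (hr : 2 ≤ r) (cShape : ℝ) (hc : 0 < cShape) :
    ∃ C : ℝ, 0 < C ∧
      ∀ (G : SplineAFEM.Grid) (Q : Finset (Fin 2 → ℤ)) (f : SplineAFEM.Plane → ℝ)
        (P M Ps : Finset SplineAFEM.Cell) (B Bs : Finset (SplineAFEM.Plane → ℝ)),
        MemLp f 2 (volume.restrict (G.domain Q)) →
        G.IsPartition Q P → (∀ β ∈ B, G.IsSpline Q r P β) → G.ShapeRegular P B cShape →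
        G.IsPartition Q Ps → (∀ β ∈ Bs, G.IsSpline Q r Ps β) → G.ShapeRegular Ps Bs cShape →
        M ⊆ P → G.IsRefinement P M Ps →
        ∀ δ : ℝ, 0 < δ →
        ∀ V ∈ Submodule.span ℝ (B : Set (SplineAFEM.Plane → ℝ)),
        ∀ Vs ∈ Submodule.span ℝ (Bs : Set (SplineAFEM.Plane → ℝ)),
          G.estimatorSq Q f Vs Ps ≤
            (1 + δ) * (G.estimatorSq Q f V P - 1 / 2 * G.estimatorSq Q f V M) +
              C * (1 + 1 / δ) * G.energySq Q (V - Vs) := by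
  obtain ⟨C, hC, H⟩ := SplineAFEM.Grid.exists_estimatorSq_zero_le r cShape
  refine ⟨C, hC, ?_⟩
  intro G Q f P M Ps B Bs hf hP hB _ hPs hBs hSs hM hR δ hδ V hV Vs hVs
  obtain ⟨p, hp, hpdeg⟩ := SplineAFEM.Grid.exists_isPiecewise_of_mem_span hB hV
  -- Each fine cell inherits the polynomial of its parent, so `V` and `Vs` can be compared on one
  -- partition without raising the degree.
  obtain ⟨q, hq, hqdeg⟩ := SplineAFEM.Grid.exists_isPiecewise_refinement hR hp hpdeg
  obtain ⟨ps, hps, hpsdeg⟩ := SplineAFEM.Grid.exists_isPiecewise_of_mem_span hBs hVs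
  have h1 := SplineAFEM.Grid.estimatorSq_le_young hPs hf hq hps hδ
  have h2 := SplineAFEM.Grid.estimatorSq_refinement_le hP hPs hf hp hM hR
  have h3 := H G Q Ps Bs _ _ hPs hSs (hq.sub hps)
    fun τ _ => Submodule.sub_mem _ (hqdeg τ) (hpsdeg τ)
  calc _ ≤ _ := h1
    _ ≤ (1 + δ) * (G.estimatorSq Q f V P - 1 / 2 * G.estimatorSq Q f V M) +
        (1 + 1 / δ) * (C * G.energySq Q (V - Vs)) := by gcongr
    _ = _ := by ring
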